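/- Let $\Lambda=\mathbb{Q}[p_1,p_2,\ldots]$ be the algebra of symmetric functions, where $p_k=\sum_j x_j^k$, and for a partition $\lambda=(\lambda_1\ge\lambda_2\ge\cdots)$ put $p_\lambda=p_{\lambda_1}p_{\lambda_2}\cdots$ and $z_\lambda=\prod_{k\ge 1}k^{m_k}m_k!$, where $m_k$ is the number of parts of $\lambda$ equal to $k$. Let $s_\lambda=\sum_T x^T$ be the Schur function, the sum being over all semistandard Young tableaux $T$ of shape $\lambda$; the $s_\lambda$ with $\lambda\vdash N$ form a basis of the homogeneous component of $\Lambda$ of degree $N$. Let $*$ be the Kronecker product on $\Lambda$, that is, the bilinear product with $\frac{p_\lambda}{z_\lambda}*\frac{p_\mu}{z_\mu}=\delta_{\lambda\mu}\frac{p_\lambda}{z_\lambda}$. For a partition $\theta$ write $l(\theta)$ for its number of parts, $\theta_i$ for its $i$-th largest part, and $d_\theta$ for the number of distinct values among its parts. Let $n\ge 2$. Then $$s_{(n,n-1,1)}*s_{(n,n)}=\sum_{\theta\vdash 2n} g^{\theta}_{(n,n-1,1)(n,n)}\,s_\theta ,$$ where the (uniquely determined) coefficients are $$g^{\theta}_{(n,n-1,1)(n,n)}=\begin{cases}1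 & \text{if } l(\theta)=5 \text{ and } \theta_5=1,\\ d_\theta-1 & \text{if } l(\theta)\le 4,\\ 0 & \text{otherwise.}\end{cases}$$ -/

import Mathlib

noncomputable section

namespace SymFun

/-- The `ℚ`-algebra `Λ` of symmetric functions: the algebra freely generated by the power sums
`p₁, p₂, …`; the variable `MvPolynomial.X k` is `p_k`. A monomial `d : ℕ+ →₀ ℕ` is `p_λ` for the
partition `λ` in which each `k` occurs `d k` times. -/
abbrev Sym : Type := MvPolynomial ℕ+ ℚ

/-- The formal power series `∑ j, x_j ^ k` (`k ≥ 1`) in countably many variables. -/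
def psumSeries (k : ℕ+) : MvPowerSeries ℕ ℚ :=
  open Classical in fun d => if ∃ j : ℕ, d = Finsupp.single j (k : ℕ) then 1 else 0

/-- The realization of symmetric functions as formal power series, `p_k ↦ ∑ j, x_j ^ k`. -/
def realize : Sym →ₐ[ℚ] MvPowerSeries ℕ ℚ :=
  MvPolynomial.aeval psumSeries

/-- `z_λ = ∏ k ^ (m_k) * m_k !`, where `m_k` is the multiplicity of `k` in `λ`. This is the order
of the centralizer of a permutation of cycle type `λ`. -/
def zee (d : ℕ+ →₀ ℕ) : ℕ :=
  d.prod fun k m => (k : ℕ) ^ m * m.factorial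

theorem zee_ne_zero (d : ℕ+ →₀ ℕ) : zee d ≠ 0 :=
  Finset.prod_ne_zero_iff.mpr fun k _ =>
    mul_ne_zero (pow_ne_zero _ k.pos.ne') (Nat.factorial_ne_zero _)

/-- The Kronecker product on `Λ`: `(∑ a_λ p_λ) * (∑ b_λ p_λ) = ∑ z_λ a_λ b_λ p_λ`. -/
def kron (f g : Sym) : Sym :=
  ∑ d ∈ f.support ∩ g.support,
    MvPolynomial.monomial d ((zee d : ℚ) * f.coeff d * g.coeff d)

theorem coeff_kron (f g : Sym) (d : ℕ+ →₀ ℕ) :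
    (kron f g).coeff d = (zee d : ℚ) * f.coeff d * g.coeff d := by
  classical
  simp only [kron, MvPolynomial.coeff_sum, MvPolynomial.coeff_monomial, Finset.sum_ite_eq',
    Finset.mem_inter, MvPolynomial.mem_support_iff]
  grind

/-- The defining property of the (bilinear) Kronecker product on the power sum basis:
`(p_λ / z_λ) * (p_μ / z_μ) = δ_{λμ} p_λ / z_λ`. -/
theorem kron_monomial (d e : ℕ+ →₀ ℕ) :
    kron (MvPolynomial.monomial d (1 / (zee d : ℚ))) (MvPolynomial.monomial e (1 / (zee e : ℚ))) =
      open Classical in if d = e then MvPolynomial.monomial d (1 / (zee d : ℚ)) else 0 := by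
  classical
  ext c
  have hz : (zee c : ℚ) ≠ 0 := by exact_mod_cast zee_ne_zero c
  rw [coeff_kron]
  by_cases hde : d = e
  · subst hde
    by_cases hdc : d = c
    · subst hdc
      simp [hz]
    · simp [MvPolynomial.coeff_monomial, hdc]
  · by_cases hdc : d = c
    · subst hdc
      simp [MvPolynomial.coeff_monomial, hde, Ne.symm hde]
    · simp [MvPolynomial.coeff_monomial, hde, hdc]

/-- The parts of a partition in weakly decreasing order. -/
def partsList {N : ℕ} (θ : N.Partition) : List ℕ :=
  θ.parts.sort (· ≥ ·)

/-- The Young diagram of a partition. -/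
def diagram {N : ℕ} (θ : N.Partition) : YoungDiagram :=
  YoungDiagram.ofRowLens (partsList θ) (Multiset.pairwise_sort θ.parts (· ≥ ·)).sortedGE

/-- The exponent of the monomial `x^T = ∏ x_{T(i,j)}` of a semistandard Young tableau. -/
def content {μ : YoungDiagram} (T : SemistandardYoungTableau μ) : ℕ →₀ ℕ :=
  ∑ c ∈ μ.cells, Finsupp.single (T c.1 c.2) 1

/-- The Schur function `s_λ = ∑_T x^T`, the sum over all semistandard Young tableaux `T` of shape
`λ`: the coefficient of `x^d` is the number of `T` with `x^T = x^d`. (Tableau entries and variable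
indices both start at `0`.) -/
def schurSeries {N : ℕ} (θ : N.Partition) : MvPowerSeries ℕ ℚ :=
  fun d => (Nat.card {T : SemistandardYoungTableau (diagram θ) // content T = d} : ℚ)

/-- The set counted in the coefficients of `schurSeries` is finite. -/
theorem finite_tableaux {μ : YoungDiagram} (d : ℕ →₀ ℕ) :
    Finite {T : SemistandardYoungTableau μ // content T = d} := by
  classical
  have key : ∀ T : {T : SemistandardYoungTableau μ // content T = d}, ∀ c : μ.cells,
      T.1 c.1.1 c.1.2 ∈ d.support := by
    rintro ⟨T, hT⟩ ⟨c, hc⟩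
    subst hT
    rw [Finsupp.mem_support_iff]
    change (∑ b ∈ μ.cells, Finsupp.single (T b.1 b.2) 1 : ℕ →₀ ℕ) (T c.1 c.2) ≠ 0
    rw [Finsupp.finsetSum_apply]
    have := Finset.single_le_sum (f := fun b : ℕ × ℕ =>
      (Finsupp.single (T b.1 b.2) 1 : ℕ →₀ ℕ) (T c.1 c.2)) (fun _ _ => Nat.zero_le _) hc
    simp only [Finsupp.single_eq_same] at this
    omega
  refine Finite.of_injective
    (fun T => fun c : μ.cells => (⟨T.1 c.1.1 c.1.2, key T c⟩ : d.support)) ?_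
  intro T T' h
  ext i j
  by_cases hc : (i, j) ∈ μ
  · have := congrFun h ⟨(i, j), hc⟩
    simpa using this
  · rw [T.1.zeros hc, T'.1.zeros hc]

/-- `g` is a family of coefficients of `s_μ * s_ν` (Kronecker product) in the Schur functions:
`s_μ` and `s_ν` are (realizations of) elements of `Λ`, and `s_μ * s_ν = ∑_θ g_θ s_θ`. -/
def IsKroneckerExpansion {N : ℕ} (μ ν : N.Partition) (g : N.Partition → ℚ) : Prop :=
  ∃ F G : Sym, realize F = schurSeries μ ∧ realize G = schurSeries ν ∧
    realize (kron F G) = ∑ θ : N.Partition, g θ • schurSeries θ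

/-- The length `l(θ)`, the number of parts. -/
def length {N : ℕ} (θ : N.Partition) : ℕ :=
  θ.parts.card

/-- The `i`-th largest part `θ_i` (`i ≥ 1`), and `0` if `i > l(θ)`. -/
def part {N : ℕ} (θ : N.Partition) (i : ℕ) : ℕ :=
  (partsList θ).getD (i - 1) 0

/-- The number `d_θ` of distinct parts. -/
def numDistinct {N : ℕ} (θ : N.Partition) : ℕ :=
  θ.parts.toFinset.card

/-- The partition `(n, n)` of `2n`, for `n ≥ 2`. -/
def partNN (n : ℕ) (hn : 2 ≤ n) : (2 * n).Partition where
  parts := {n, n}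
  parts_pos := by
    intro i hi
    simp only [Multiset.insert_eq_cons, Multiset.mem_cons, Multiset.mem_singleton] at hi
    omega
  parts_sum := by
    simp only [Multiset.insert_eq_cons, Multiset.sum_cons, Multiset.sum_singleton]
    omega

/-- The partition `(n, n - 1, 1)` of `2n`, for `n ≥ 2`. -/
def partNearRect (n : ℕ) (hn : 2 ≤ n) : (2 * n).Partition where
  parts := {n, n - 1, 1}
  parts_pos := by
    intro i hi
    simp only [Multiset.insert_eq_cons, Multiset.mem_cons, Multiset.mem_singleton] at hi
    omega
  parts_sum := by
    simp only [Multiset.insert_eq_cons, Multiset.sum_cons, Multiset.sum_singleton]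
    omega

end SymFun

end

noncomputable section

namespace SymFun

open Finset.HasAntidiagonal

/-! The shape (n,n-1,1) is reached from (n,n-1) by one added cell, so Pieri gives s_(n,n-1,1) = h_1
s_(n,n-1) - s_(n+1,n-1) - s_(n,n). Multiplication by p_1 = h_1 is adjoint to ∂/∂p_1, and
∂s_(n,n)/∂p_1 = s_(n,n-1). Hence the product is h_1 · (s_(n,n-1) * s_(n,n-1)) - (s_(n+1,n-1) +
s_(n,n)) * s_(n,n) (`kron_nearRect`).

Both Kronecker products on the right are the sum of all s_θ of their degree with at most four rows
(`kron_odd`, `kron_even`). Two computations meet here. On one side, h_c h_d * h_a h_b is a sum over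
2×2 matrices with given margins, which is a coefficient of D_s D_t, where D_s (`diffSeries`)
collects the h_u h_v with u - v = s. On the other side, expanding all four-row Jacobi–Trudi
determinants leaves sorting signs as coefficients. These signs form a 4×4 Pfaffian of signs of
differences, so the sum is a quadratic polynomial in the D_s.

Applying Pieri again, the coefficient of s_θ is the number of corners of θ whose removal leaves at
most four rows, less 1 if θ itself has at most four rows. The corners correspond to the distinct
parts, which yields the stated formula.

The link with tableaux is the Jacobi–Trudi identity, proved by adding one variable at a time.
Uniqueness follows from injectivity of `realize` and linear independence of the Schur series. -/

/-! ### Linear differential equations for formal power series -/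

open PowerSeries in
theorem coeff_X_mul_derivative {A : Type*} [CommRing A] (f : A⟦X⟧) (n : ℕ) :
    coeff n (X * d⁄dX A f) = n * coeff n f := by
  cases n with
  | zero => simp
  | succ n =>
    rw [PowerSeries.coeff_succ_X_mul, coeff_derivative]
    push_cast; ring

open PowerSeries in
/-- A solution of the linear differential equation `X f' = P f` over a `ℚ`-algebra, where `P` has
no constant term, is determined by its constant term. -/
theorem eq_zero_of_X_mul_derivative_eq {A : Type*} [CommRing A] [Algebra ℚ A] {P E : A⟦X⟧}
    (hP : coeff 0 P = 0) (h : X * d⁄dX A E = P * E) (h0 : coeff 0 E = 0) : E = 0 := by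
  ext n
  induction n using Nat.strong_induction_on with
  | _ n ih =>
    rcases Nat.eq_zero_or_pos n with rfl | hn
    · simpa using h0
    · have h1 := congrArg (coeff n) h
      rw [coeff_X_mul_derivative, coeff_mul, Finset.sum_eq_zero] at h1
      · have h2 : ((n : ℚ)⁻¹ • ((n : A) * coeff n E)) = coeff n E := by
          have : (n : A) = algebraMap ℚ A n := by simp
          rw [this, ← Algebra.smul_def, smul_smul, inv_mul_cancel₀ (by positivity), one_smul]
        rw [← h2, h1]; simp
      · rintro ⟨i, j⟩ hij
        replace hij : i + j = n := by simpa using hij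
        dsimp only
        rcases Nat.eq_zero_or_pos i with rfl | hi
        · rw [hP, zero_mul]
        · rw [ih j (by omega)]; simp

/-! ### Complete homogeneous functions and their derivatives in the power sums -/

/-- The complete homogeneous symmetric functions, by Newton's recursion. -/
def hsym : ℕ → Sym
  | 0 => 1
  | n + 1 => MvPolynomial.C (1 / ((n : ℚ) + 1)) *
      ∑ k : Fin (n + 1), MvPolynomial.X k.1.succPNat * hsym (n - k.1)

/-- The power sums, with `0` at index `0`. -/
def psym (n : ℕ) : Sym := if n = 0 then 0 else MvPolynomial.X n.toPNat'

theorem psym_coe (k : ℕ+) : psym k = MvPolynomial.X k := by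
  simp [psym]

def pSeries : PowerSeries Sym := PowerSeries.mk psym

def hSeries : PowerSeries Sym := PowerSeries.mk hsym

theorem coeff_zero_pSeries : PowerSeries.coeff 0 pSeries = 0 := by
  simp [pSeries, psym]

theorem X_mul_derivative_hSeries :
    PowerSeries.X * PowerSeries.derivative Sym hSeries = pSeries * hSeries := by
  ext1 n
  rw [coeff_X_mul_derivative, PowerSeries.coeff_mul]
  cases n with
  | zero => simp [pSeries, psym]
  | succ n =>
    rw [Finset.Nat.antidiagonal_succ, Finset.sum_cons, Finset.sum_map]
    simp only [coeff_zero_pSeries, zero_mul, zero_add, Function.Embedding.prodMap,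
      Function.Embedding.coeFn_mk, Prod.map]
    simp only [pSeries, hSeries, PowerSeries.coeff_mk]
    rw [hsym, Finset.Nat.sum_antidiagonal_eq_sum_range_succ_mk, Finset.sum_range]
    rw [← mul_assoc]
    have : ((n + 1 : ℕ) : Sym) * MvPolynomial.C (1 / ((n : ℚ) + 1)) = 1 := by
      have h : ((n + 1 : ℕ) : Sym) = MvPolynomial.C ((n : ℚ) + 1) := by simp
      rw [h, ← MvPolynomial.C_mul, mul_one_div_cancel (by positivity), MvPolynomial.C_1]
    rw [this, one_mul]
    refine Finset.sum_congr rfl fun k _ => ?_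
    simp [Nat.toPNat', psym]

/-- The complete homogeneous symmetric functions, with `0` at negative indices. -/
def hZ (m : ℤ) : Sym := if 0 ≤ m then hsym m.toNat else 0

theorem hZ_natCast (n : ℕ) : hZ n = hsym n := by simp [hZ]

theorem hZ_of_neg {m : ℤ} (h : m < 0) : hZ m = 0 := by simp [hZ, h]

theorem hsym_zero : hsym 0 = 1 := by rw [hsym]

theorem hZ_zero : hZ 0 = 1 := by simp [hZ, hsym]

theorem hsym_one : hsym 1 = MvPolynomial.X 1 := by
  rw [hsym]
  have : Nat.succPNat 0 = 1 := rfl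
  simp [hsym_zero, this]

theorem hZ_one : hZ 1 = MvPolynomial.X 1 := by simp [hZ, hsym_one]

/-- Write H and P for `hSeries` and `pSeries`. Since ∂P/∂p_k = X^k, differentiating X H' = P H shows
that both sides solve X f' = P f + k X^k H. Their difference solves the homogeneous equation and has
no constant term. -/
theorem pderiv_hSeries (k : ℕ+) :
    PowerSeries.mk (fun n => (k : Sym) * MvPolynomial.pderiv k (hsym n)) =
      PowerSeries.X ^ (k : ℕ) * hSeries := by
  rw [← sub_eq_zero]
  refine eq_zero_of_X_mul_derivative_eq coeff_zero_pSeries ?_ ?_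
  · have h1 : PowerSeries.X * PowerSeries.derivative Sym
        (PowerSeries.mk fun n => (k : Sym) * MvPolynomial.pderiv k (hsym n)) =
        (k : PowerSeries Sym) * (PowerSeries.X ^ (k : ℕ) * hSeries) + pSeries *
          PowerSeries.mk (fun n => (k : Sym) * MvPolynomial.pderiv k (hsym n)) := by
      have h2 : PowerSeries.mk (fun n => MvPolynomial.pderiv k (psym n)) =
          PowerSeries.X ^ (k : ℕ) := by
        ext1 n
        rw [PowerSeries.coeff_mk, PowerSeries.coeff_X_pow]
        unfold psym
        split_ifs with h h' h'
        · exact absurd (h'.symm.trans h) k.ne_zero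
        · simp
        · subst h'; simp
        · rw [MvPolynomial.pderiv_X_of_ne]
          intro h''
          apply h'
          rw [← h'', Nat.toPNat'_coe, if_pos (Nat.pos_of_ne_zero h)]
      rw [← h2]
      ext1 n
      have h3 := congrArg (fun f => (k : Sym) * MvPolynomial.pderiv k (PowerSeries.coeff n f))
        X_mul_derivative_hSeries
      simp only [coeff_X_mul_derivative] at h3
      simp only [PowerSeries.coeff_mul, map_sum, Derivation.leibniz,
        smul_eq_mul, Derivation.map_natCast, mul_zero, add_zero, pSeries, hSeries,
        PowerSeries.coeff_mk] at h3
      have h4 : (k : PowerSeries Sym) = PowerSeries.C (k : Sym) := by simp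
      rw [coeff_X_mul_derivative, h4, map_add, PowerSeries.coeff_C_mul, PowerSeries.coeff_mul,
        PowerSeries.coeff_mul]
      simp only [pSeries, hSeries, PowerSeries.coeff_mk]
      rw [mul_left_comm, h3, Finset.mul_sum, Finset.mul_sum, ← Finset.sum_add_distrib]
      exact Finset.sum_congr rfl fun _ _ => by ring
    rw [map_sub, mul_sub, h1, Derivation.leibniz, Derivation.leibniz_pow]
    have h5 := X_mul_derivative_hSeries
    have h6 : (PowerSeries.X : PowerSeries Sym) * PowerSeries.X ^ ((k : ℕ) - 1) =
      PowerSeries.X ^ (k : ℕ) := mul_pow_sub_one k.ne_zero _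
    simp only [PowerSeries.derivative_X, smul_eq_mul, nsmul_eq_mul, mul_one]
    linear_combination (-PowerSeries.X ^ (k : ℕ)) * h5 - (k : PowerSeries Sym) * hSeries * h6
  · simp [hsym_zero]

/-- `k ∂h_m/∂p_k = h_{m-k}`. -/
theorem pderiv_hZ (k : ℕ+) (m : ℤ) :
    (k : Sym) * MvPolynomial.pderiv k (hZ m) = hZ (m - k) := by
  rcases lt_or_ge m 0 with hm | hm
  · have := k.pos
    rw [hZ_of_neg hm, hZ_of_neg (by omega)]; simp
  · lift m to ℕ using hm
    have h := congrArg (PowerSeries.coeff m) (pderiv_hSeries k)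
    rw [PowerSeries.coeff_mk, PowerSeries.coeff_X_pow_mul', hSeries, PowerSeries.coeff_mk] at h
    rw [hZ_natCast, h]
    split_ifs with hk
    · rw [← hZ_natCast]; congr 1; push_cast [hk]; rfl
    · rw [hZ_of_neg]; omega

/-! ### The Kronecker product with h_a h_b -/

theorem kron_add_left (f f' g : Sym) : kron (f + f') g = kron f g + kron f' g := by
  ext d; simp only [coeff_kron, MvPolynomial.coeff_add]; ring

theorem kron_sub_left (f f' g : Sym) : kron (f - f') g = kron f g - kron f' g := by
  ext d; simp only [coeff_kron, MvPolynomial.coeff_sub]; ring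

theorem kron_add_right (f g g' : Sym) : kron f (g + g') = kron f g + kron f g' := by
  ext d; simp only [coeff_kron, MvPolynomial.coeff_add]; ring

theorem kron_sub_right (f g g' : Sym) : kron f (g - g') = kron f g - kron f g' := by
  ext d; simp only [coeff_kron, MvPolynomial.coeff_sub]; ring

theorem zee_add_single (d : ℕ+ →₀ ℕ) (k : ℕ+) :
    zee (d + Finsupp.single k 1) = k * (d k + 1) * zee d := by
  classical
  have hs : ∀ e : ℕ+ →₀ ℕ, e.support ⊆ insert k d.support →
      zee e = ∏ i ∈ insert k d.support, (i : ℕ) ^ e i * (e i).factorial := fun e he =>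
    Finsupp.prod_of_support_subset _ he _ (by simp)
  rw [hs d (Finset.subset_insert _ _), hs (d + Finsupp.single k 1),
    ← Finset.mul_prod_erase _ _ (Finset.mem_insert_self k _),
    ← Finset.mul_prod_erase (insert k d.support) (fun i => (i : ℕ) ^ d i * (d i).factorial)
      (Finset.mem_insert_self k _)]
  · have : ∏ i ∈ (insert k d.support).erase k,
        (i : ℕ) ^ (d + Finsupp.single k 1 : ℕ+ →₀ ℕ) i *
          ((d + Finsupp.single k 1 : ℕ+ →₀ ℕ) i).factorial =
        ∏ i ∈ (insert k d.support).erase k, (i : ℕ) ^ d i * (d i).factorial := by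
      refine Finset.prod_congr rfl fun i hi => ?_
      have : k ≠ i := (Finset.ne_of_mem_erase hi).symm
      simp [this]
    rw [this]
    simp only [Finsupp.add_apply, Finsupp.single_eq_same, Nat.factorial_succ, pow_succ]
    ring
  · intro i hi
    simp only [Finsupp.mem_support_iff, Finsupp.add_apply, Finsupp.single_apply,
      Finset.mem_insert] at hi ⊢
    by_contra hc
    push Not at hc
    exact hi (by simp [hc.2, hc.1.symm])

/-- Multiplication by `p_k` is adjoint to `k ∂/∂p_k`. -/
theorem kron_X_mul (k : ℕ+) (f g : Sym) :
    kron (MvPolynomial.X k * f) g =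
      MvPolynomial.X k * kron f ((k : Sym) * MvPolynomial.pderiv k g) := by
  classical
  ext d
  rw [coeff_kron, MvPolynomial.coeff_X_mul', MvPolynomial.coeff_X_mul']
  split_ifs with h
  · obtain ⟨e, rfl⟩ : ∃ e, d = e + Finsupp.single k 1 := by
      refine ⟨d - Finsupp.single k 1, (tsub_add_cancel_of_le ?_).symm⟩
      rw [Finsupp.single_le_iff]
      exact Nat.one_le_iff_ne_zero.mpr (Finsupp.mem_support_iff.mp h)
    have hk : ((k : ℕ) : Sym) = MvPolynomial.C (k : ℚ) := by simp
    rw [add_tsub_cancel_right, coeff_kron, zee_add_single, hk, MvPolynomial.coeff_C_mul,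
      MvPolynomial.coeff_pderiv]
    push_cast
    ring
  · simp

theorem constantCoeff_hsym (n : ℕ) :
    MvPolynomial.constantCoeff (hsym n) = if n = 0 then 1 else 0 := by
  cases n with
  | zero => simp [hsym_zero]
  | succ n => rw [hsym]; simp

theorem constantCoeff_hZ (m : ℤ) : MvPolynomial.constantCoeff (hZ m) = if m = 0 then 1 else 0 := by
  rcases lt_or_ge m 0 with hm | hm
  · rw [hZ_of_neg hm, if_neg hm.ne, map_zero]
  · lift m to ℕ using hm
    simp [hZ_natCast, constantCoeff_hsym]

/-- The homomorphism `p_k ↦ p_k (u^k + v^k)` into Laurent polynomials in `u`, `v`. -/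
def dilate : Sym →ₐ[ℚ] AddMonoidAlgebra Sym (ℤ × ℤ) :=
  MvPolynomial.aeval fun k : ℕ+ =>
    AddMonoidAlgebra.single ((k : ℤ), (0 : ℤ)) (MvPolynomial.X k : Sym) +
      AddMonoidAlgebra.single ((0 : ℤ), (k : ℤ)) (MvPolynomial.X k : Sym)

/-- Both sides obey the same recursion when f is multiplied by p_k. On the left, adjointness and
`pderiv_hZ` lower a or b by k; on the right, the factor u^k + v^k shifts the exponent. Integer
indices keep the recursion free of boundary cases. -/
theorem kron_hZ_mul_hZ (f : Sym) (a b : ℤ) : kron f (hZ a * hZ b) = (dilate f).coeff (a, b) := by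
  induction f using MvPolynomial.induction_on generalizing a b with
  | C r =>
    have h1 : dilate (MvPolynomial.C r) = AddMonoidAlgebra.single (0, 0) (MvPolynomial.C r) := by
      rw [dilate, MvPolynomial.aeval_C]
      rfl
    ext d
    have h0 := constantCoeff_hZ a
    have h0' := constantCoeff_hZ b
    have hz : zee 0 = 1 := by simp [zee]
    rw [h1, coeff_kron, MvPolynomial.coeff_C]
    rw [AddMonoidAlgebra.coeff_single, Finsupp.single_apply]
    by_cases hd : 0 = d
    · subst hd
      rw [← MvPolynomial.constantCoeff_eq, map_mul, h0, h0', hz]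
      by_cases ha : a = 0 <;> by_cases hb : b = 0 <;> simp [ha, hb, eq_comm]
    · split_ifs <;> simp [MvPolynomial.coeff_C, hd]
  | add f g hf hg => rw [kron_add_left, hf, hg, map_add]; rfl
  | mul_X f k hf =>
    rw [mul_comm, kron_X_mul, Derivation.leibniz, smul_eq_mul, smul_eq_mul, mul_add]
    rw [mul_left_comm, mul_left_comm _ (hZ b), pderiv_hZ, pderiv_hZ, mul_comm (hZ b),
      kron_add_right, hf, hf, map_mul]
    have : dilate (MvPolynomial.X k) =
        AddMonoidAlgebra.single ((k : ℤ), (0 : ℤ)) (MvPolynomial.X k : Sym) +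
      AddMonoidAlgebra.single ((0 : ℤ), (k : ℤ)) (MvPolynomial.X k : Sym) := by
      rw [dilate, MvPolynomial.aeval_X]
    rw [this, add_mul, AddMonoidAlgebra.coeff_add, Finsupp.add_apply,
      AddMonoidAlgebra.coeff_single_mul_apply, AddMonoidAlgebra.coeff_single_mul_apply]
    simp only [Prod.neg_mk, Prod.mk_add_mk, neg_zero, zero_add, neg_add_eq_sub]
    ring

open PowerSeries in
theorem X_mul_derivative_mul {A : Type*} [CommRing A] {P Q F G : A⟦X⟧}
    (hF : X * d⁄dX A F = P * F) (hG : X * d⁄dX A G = Q * G) :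
    X * d⁄dX A (F * G) = (P + Q) * (F * G) := by
  rw [Derivation.leibniz, smul_eq_mul, smul_eq_mul]
  linear_combination G * hF + F * hG

theorem X_mul_derivative_mk_single (w : ℤ × ℤ) :
    PowerSeries.X * PowerSeries.derivative (AddMonoidAlgebra Sym (ℤ × ℤ))
        (PowerSeries.mk fun n => AddMonoidAlgebra.single (n • w) (hsym n)) =
      (PowerSeries.mk fun n => AddMonoidAlgebra.single (n • w) (psym n)) *
        (PowerSeries.mk fun n => AddMonoidAlgebra.single (n • w) (hsym n)) := by
  ext1 n
  have h := congrArg (PowerSeries.coeff n) X_mul_derivative_hSeries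
  rw [coeff_X_mul_derivative, PowerSeries.coeff_mul] at h
  simp only [pSeries, hSeries, PowerSeries.coeff_mk] at h
  rw [coeff_X_mul_derivative, PowerSeries.coeff_mul]
  simp only [PowerSeries.coeff_mk, AddMonoidAlgebra.single_mul_single, ← add_smul]
  rw [← nsmul_eq_mul, AddMonoidAlgebra.smul_single, nsmul_eq_mul (a := hsym n), h]
  have hs : ∀ x ∈ antidiagonal n,
      AddMonoidAlgebra.single ((x.1 + x.2) • w) (psym x.1 * hsym x.2) =
        AddMonoidAlgebra.singleAddHom (n • w) (psym x.1 * hsym x.2) := fun x hx => by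
    rw [mem_antidiagonal.mp hx]; rfl
  rw [Finset.sum_congr rfl hs, ← map_sum]
  rfl

/-- With H and P for `hSeries` and `pSeries`, this is the coproduct formula H ↦ H(uX) H(vX): both
sides solve the equation with P replaced by P(uX) + P(vX). -/
theorem map_dilate_hSeries :
    PowerSeries.map (dilate : Sym →+* _) hSeries =
      (PowerSeries.mk fun n => AddMonoidAlgebra.single (n • ((1, 0) : ℤ × ℤ)) (hsym n)) *
        (PowerSeries.mk fun n => AddMonoidAlgebra.single (n • ((0, 1) : ℤ × ℤ)) (hsym n)) := by
  rw [← sub_eq_zero]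
  have hP : PowerSeries.map (dilate : Sym →+* _) pSeries =
      (PowerSeries.mk fun n => AddMonoidAlgebra.single (n • ((1, 0) : ℤ × ℤ)) (psym n)) +
        (PowerSeries.mk fun n => AddMonoidAlgebra.single (n • ((0, 1) : ℤ × ℤ)) (psym n)) := by
    ext1 n
    simp only [pSeries, PowerSeries.coeff_map, PowerSeries.coeff_mk, map_add]
    rcases Nat.eq_zero_or_pos n with rfl | hn
    · simp [psym]
    · obtain ⟨k, rfl⟩ : ∃ k : ℕ+, n = k := ⟨⟨n, hn⟩, rfl⟩
      rw [psym_coe]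
      simp [dilate]
  refine eq_zero_of_X_mul_derivative_eq
    (P := PowerSeries.map (dilate : Sym →+* _) pSeries) ?_ ?_ ?_
  · rw [PowerSeries.coeff_map, coeff_zero_pSeries, map_zero]
  · have h1 : PowerSeries.X * PowerSeries.derivative _ 
          (PowerSeries.map (dilate : Sym →+* AddMonoidAlgebra Sym (ℤ × ℤ)) hSeries) =
        PowerSeries.map (dilate : Sym →+* _) pSeries *
          PowerSeries.map (dilate : Sym →+* _) hSeries := by
      rw [← map_mul, ← X_mul_derivative_hSeries]
      ext1 n
      rw [coeff_X_mul_derivative, PowerSeries.coeff_map, PowerSeries.coeff_map,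
        coeff_X_mul_derivative, map_mul, map_natCast]
    have h2 := X_mul_derivative_mk_single (1, 0)
    have h3 := X_mul_derivative_mk_single (0, 1)
    rw [map_sub, mul_sub, h1, X_mul_derivative_mul h2 h3, mul_sub, hP]
  · rw [map_sub, PowerSeries.coeff_map, PowerSeries.coeff_mul]
    simp [hSeries, hsym_zero, AddMonoidAlgebra.single_mul_single]
    exact sub_self _

theorem dilate_hsym (n : ℕ) :
    dilate (hsym n) = ∑ x ∈ antidiagonal n,
      AddMonoidAlgebra.single ((x.1 : ℤ), (x.2 : ℤ)) (hsym x.1 * hsym x.2) := by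
  have h := congrArg (PowerSeries.coeff n) map_dilate_hSeries
  rw [PowerSeries.coeff_mul, PowerSeries.coeff_map, hSeries, PowerSeries.coeff_mk] at h
  refine h.trans (Finset.sum_congr rfl fun x _ => ?_)
  simp [AddMonoidAlgebra.single_mul_single]

/-- The Kronecker product of `h_c h_d` and `h_a h_b` is the sum of `h_i h_j h_k h_l` over all
matrices of nonnegative integers with rows `(i, j)`, `(k, l)`, row sums `c, d` and column sums
`a, b`. -/
theorem kron_hsym_mul_hsym (a b c d : ℕ) :
    kron (hsym c * hsym d) (hsym a * hsym b) =
      ∑ x ∈ antidiagonal c, ∑ y ∈ antidiagonal d,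
        if x.1 + y.1 = a ∧ x.2 + y.2 = b then
          hsym x.1 * hsym x.2 * (hsym y.1 * hsym y.2) else 0 := by
  rw [← hZ_natCast a, ← hZ_natCast b, kron_hZ_mul_hZ, map_mul, dilate_hsym, dilate_hsym,
    Finset.sum_mul_sum]
  simp only [AddMonoidAlgebra.single_mul_single, AddMonoidAlgebra.coeff_sum,
    Finsupp.finsetSum_apply, AddMonoidAlgebra.coeff_single, Finsupp.single_apply]
  refine Finset.sum_congr rfl fun x _ => Finset.sum_congr rfl fun y _ => ?_
  refine if_congr ?_ rfl rfl
  rw [Prod.mk_add_mk, Prod.mk.injEq]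
  norm_cast

/-! ### Jacobi–Trudi determinants: Pieri rule and branching -/

/-- The Jacobi–Trudi determinant `det (h_{a_i - i + j})`. -/
def jacobiTrudi {R : Type*} [CommRing R] (h : ℤ → R) {r : ℕ} (a : Fin r → ℤ) : R :=
  (Matrix.of fun i j : Fin r => h (a i - (i : ℕ) + (j : ℕ))).det

theorem map_jacobiTrudi {R S : Type*} [CommRing R] [CommRing S] (f : R →+* S) (h : ℤ → R) {r : ℕ}
    (a : Fin r → ℤ) : f (jacobiTrudi h a) = jacobiTrudi (fun m => f (h m)) a := by
  rw [jacobiTrudi, RingHom.map_det]; rfl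

theorem jacobiTrudi_eq_zero {R : Type*} [CommRing R] (h : ℤ → R) {r : ℕ} (a : Fin r → ℤ)
    {i j : Fin r} (hij : i ≠ j) (ha : a i - (i : ℕ) = a j - (j : ℕ)) : jacobiTrudi h a = 0 :=
  Matrix.det_zero_of_row_eq hij (by ext k; simp [ha])

/-- Both sums are the trace of adj(M) M'. In the Pieri rule this trades raising one row for shifting
one column, and a shifted column usually duplicates its neighbour. -/
theorem sum_det_updateRow_eq_sum_det_updateCol {R ι : Type*} [CommRing R] [Fintype ι]
    [DecidableEq ι] (M M' : Matrix ι ι R) :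
    ∑ i, (M.updateRow i (M' i)).det = ∑ j, (M.updateCol j fun i => M' i j).det := by
  have h : ∀ M M' : Matrix ι ι R,
      ∑ j, (M.updateCol j fun i => M' i j).det = (M.adjugate * M').trace := fun M M' => by
    refine Finset.sum_congr rfl fun j _ => ?_
    rw [← Matrix.cramer_apply, Matrix.cramer_eq_adjugate_mulVec]
    rfl
  have h' : ∑ i, (M.updateRow i (M' i)).det =
      ∑ i, (M.transpose.updateCol i fun j => M'.transpose j i).det := by
    refine Finset.sum_congr rfl fun i _ => ?_
    rw [← Matrix.det_transpose, ← Matrix.updateCol_transpose]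
    rfl
  rw [h', h, h, ← Matrix.adjugate_transpose, ← Matrix.transpose_mul, Matrix.trace_transpose,
    Matrix.trace_mul_comm]

theorem det_of_last_row {R : Type*} [CommRing R] {r : ℕ} (A : Matrix (Fin (r + 1)) (Fin (r + 1)) R)
    (h : ∀ j : Fin r, A (Fin.last r) j.castSucc = 0) :
    A.det = A (Fin.last r) (Fin.last r) * (A.submatrix Fin.castSucc Fin.castSucc).det := by
  rw [Matrix.det_succ_row A (Fin.last r), Fin.sum_univ_castSucc, Finset.sum_eq_zero]
  · rw [zero_add, Fin.succAbove_last, ← two_mul, pow_mul, neg_one_sq, one_pow, one_mul]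
  · intro j _
    rw [h, mul_zero, zero_mul]

theorem jacobiTrudi_snoc_zero {R : Type*} [CommRing R] {h : ℤ → R} (h0 : h 0 = 1)
    (hneg : ∀ m < 0, h m = 0) {r : ℕ} (a : Fin r → ℤ) :
    jacobiTrudi h (Fin.snoc a 0 : Fin (r + 1) → ℤ) = jacobiTrudi h a := by
  rw [jacobiTrudi, det_of_last_row]
  · simp [h0, jacobiTrudi, Matrix.submatrix]
  · intro j
    have := j.2
    simp only [Matrix.of_apply, Fin.snoc_last, Fin.val_last, Fin.val_castSucc]
    exact hneg _ (by omega)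

/-- The Pieri rule for multiplication by `h_1`. -/
theorem sum_jacobiTrudi_update {R : Type*} [CommRing R] {h : ℤ → R}
    (hneg : ∀ m < 0, h m = 0) {r : ℕ} (a : Fin r → ℤ) :
    ∑ i : Fin (r + 1), jacobiTrudi h
      (Function.update (Fin.snoc a 0 : Fin (r + 1) → ℤ) i ((Fin.snoc a 0 : Fin (r + 1) → ℤ) i + 1)) =
      h 1 * jacobiTrudi h a := by
  set b : Fin (r + 1) → ℤ := Fin.snoc a 0 with hb
  let M : Matrix (Fin (r + 1)) (Fin (r + 1)) R := Matrix.of fun i j => h (b i - (i : ℕ) + (j : ℕ))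
  let M' : Matrix (Fin (r + 1)) (Fin (r + 1)) R :=
    Matrix.of fun i j => h (b i - (i : ℕ) + (j : ℕ) + 1)
  have h1 : ∀ i, jacobiTrudi h (Function.update b i (b i + 1)) = (M.updateRow i (M' i)).det := by
    intro i
    rw [jacobiTrudi]
    congr 1
    ext k j
    rw [Matrix.updateRow_apply]
    by_cases hk : k = i
    · subst hk
      simp only [Matrix.of_apply, Function.update_self, if_true, M']
      congr 1; ring
    · simp [hk, M]
  -- Shifting a column other than the last makes it equal to the next one, so only the last
  -- survives. There the bottom row is zero except for the corner entry h 1.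
  rw [Finset.sum_congr rfl fun i _ => h1 i, sum_det_updateRow_eq_sum_det_updateCol,
    Fin.sum_univ_castSucc, Finset.sum_eq_zero, zero_add, det_of_last_row]
  · congr 1
    · simp [M', hb]
    · rw [jacobiTrudi]
      congr 1
      ext i j
      simp [M, hb]
  · intro j
    have := j.2
    simp only [Matrix.updateCol_apply, j.castSucc_ne_last, if_false]
    simp only [M, hb, Matrix.of_apply, Fin.snoc_last, Fin.val_last, Fin.val_castSucc]
    exact hneg _ (by omega)
  · intro j _
    refine Matrix.det_zero_of_column_eq (i := j.castSucc) (j := j.succ)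
      j.castSucc_lt_succ.ne fun i => ?_
    rw [Matrix.updateCol_apply, Matrix.updateCol_apply, if_pos rfl,
      if_neg j.castSucc_lt_succ.ne']
    simp only [M, M', Matrix.of_apply, Fin.val_castSucc, Fin.val_succ]
    congr 1; push_cast; ring

/-- The entry after the `i`-th, and `0` after the last. -/
def nextEntry {r : ℕ} (a : Fin r → ℕ) (i : Fin r) : ℕ :=
  if h : (i : ℕ) + 1 < r then a ⟨i + 1, h⟩ else 0

theorem nextEntry_le {r : ℕ} {a : Fin r → ℕ} (ha : Antitone a) (i : Fin r) :
    nextEntry a i ≤ a i := by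
  unfold nextEntry
  split_ifs with h
  · exact ha (Fin.le_def.mpr (Nat.le_succ _))
  · exact Nat.zero_le _

/-- Each summand is y^(q-m) H(m+c) - y^(q-m+1) H(m-1+c), so consecutive terms cancel. -/
theorem sum_Icc_telescope {R : Type*} [CommRing R] {h H : ℤ → R} {y : R}
    (hH : ∀ m, h m = H m - y * H (m - 1)) {p q : ℕ} (hpq : p ≤ q) (c : ℤ) :
    ∑ m ∈ Finset.Icc p q, y ^ (q - m) * h (m + c) =
      H (q + c) - y ^ (q - p + 1) * H (p + c - 1) := by
  induction q, hpq using Nat.le_induction with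
  | base => simp [hH]
  | succ q hq ih =>
    have hs : ∀ m ∈ Finset.Icc p q, y ^ (q + 1 - m) * h (m + c) = y * (y ^ (q - m) * h (m + c)) := by
      intro m hm
      rw [Finset.mem_Icc] at hm
      rw [Nat.sub_add_comm hm.2, pow_succ]; ring
    rw [← Finset.insert_Icc_right_eq_Icc_add_one (by omega), Finset.sum_insert (by simp),
      Finset.sum_congr rfl hs, ← Finset.mul_sum, ih, hH, Nat.sub_add_comm hq, Nat.sub_self]
    have : ((q + 1 : ℕ) : ℤ) + c - 1 = q + c := by push_cast; ring
    rw [this]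
    ring

/-- The row operations amount to left multiplication by a unipotent upper triangular matrix. -/
theorem det_eq_of_row_sub_smul_next {R : Type*} [CommRing R] {r : ℕ}
    (A B : Matrix (Fin r) (Fin r) R) (c : Fin r → R)
    (h : ∀ i j, B i j = A i j - c i * if h : (i : ℕ) + 1 < r then A ⟨i + 1, h⟩ j else 0) :
    B.det = A.det := by
  let N : Matrix (Fin r) (Fin r) R := Matrix.of fun i k => if (k : ℕ) = i + 1 then c i else 0
  have hB : B = (1 - N) * A := by
    ext i j
    rw [sub_mul, one_mul, Matrix.sub_apply, h, Matrix.mul_apply]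
    congr 1
    split_ifs with hi
    · rw [Finset.sum_eq_single ⟨i + 1, hi⟩]
      · simp [N]
      · intro k _ hk
        have : (k : ℕ) ≠ i + 1 := fun h' => hk (Fin.ext h')
        simp [N, this]
      · simp
    · rw [Finset.sum_eq_zero, mul_zero]
      intro k _
      have : (k : ℕ) ≠ i + 1 := by have := k.2; omega
      simp [N, this]
  have hN : (1 - N).det = 1 := by
    rw [Matrix.det_of_isUpperTriangular]
    · simp [N]
    · intro i j hij
      have hij' : j < i := hij
      have : (j : ℕ) ≠ i + 1 := by have := Fin.lt_def.mp hij'; omega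
      simp [N, this, hij'.ne']
  rw [hB, Matrix.det_mul, hN, one_mul]

/-- Branching of Jacobi–Trudi determinants when one variable `y` is added. -/
theorem sum_jacobiTrudi_interlacing {R : Type*} [CommRing R] {h H : ℤ → R} {y : R}
    (hH : ∀ m, h m = H m - y * H (m - 1)) (hneg : ∀ m < 0, H m = 0) {r : ℕ} {a : Fin r → ℕ}
    (ha : Antitone a) :
    ∑ b ∈ Fintype.piFinset fun i => Finset.Icc (nextEntry a i) (a i),
        y ^ (∑ i, (a i - b i)) * jacobiTrudi h (fun i => (b i : ℤ)) =
      jacobiTrudi H fun i => (a i : ℤ) := by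
  have h1 : ∀ b : Fin r → ℕ, y ^ (∑ i, (a i - b i)) * jacobiTrudi h (fun i => (b i : ℤ)) =
      (Matrix.detRowAlternating : (Fin r → R) [⋀^Fin r]→ₗ[R] R).toMultilinearMap
        fun i j => y ^ (a i - b i) * h (b i + (-(i : ℕ) + (j : ℕ))) := by
    intro b
    rw [← Finset.prod_pow_eq_pow_sum, jacobiTrudi, ← Matrix.det_mul_column]
    change _ = Matrix.det _
    congr 1
    ext i j
    simp [sub_eq_add_neg, add_assoc]
  rw [Finset.sum_congr rfl fun b _ => h1 b]
  -- The entries of b range over independent intervals, so multilinearity moves the sum inside each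
  -- row. There it telescopes to row i of the H-matrix minus a multiple of row i+1.
  have h2 := MultilinearMap.map_sum_finset
    (Matrix.detRowAlternating : (Fin r → R) [⋀^Fin r]→ₗ[R] R).toMultilinearMap
    (fun (i : Fin r) (m : ℕ) (j : Fin r) => y ^ (a i - m) * h (m + (-(i : ℕ) + (j : ℕ))))
    (fun i => Finset.Icc (nextEntry a i) (a i))
  rw [← h2]
  change Matrix.det _ = Matrix.det _
  refine det_eq_of_row_sub_smul_next _ _ (fun i => y ^ (a i - nextEntry a i + 1)) fun i j => ?_
  rw [Finset.sum_apply, sum_Icc_telescope hH (nextEntry_le ha i)]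
  congr 1
  · rw [Matrix.of_apply]; congr 1; ring
  · congr 1
    unfold nextEntry
    split_ifs with hi
    · rw [Matrix.of_apply]; congr 1; push_cast; ring
    -- Below the last row `nextEntry` is 0, so the subtracted index is j - r, which is negative.
    · have := j.2
      exact hneg _ (by push_cast; omega)

/-! ### Power series in the variables x_j and the image of h_n -/

/-- Setting the variables `x_j`, `j ≥ k`, to zero, as a function. -/
def truncVarsFun (k : ℕ) (f : MvPowerSeries ℕ ℚ) : MvPowerSeries ℕ ℚ :=
  fun d => if d.support ⊆ Finset.range k then MvPowerSeries.coeff d f else 0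

theorem coeff_truncVarsFun (k : ℕ) (f : MvPowerSeries ℕ ℚ) (d : ℕ →₀ ℕ) :
    MvPowerSeries.coeff d (truncVarsFun k f) =
      if d.support ⊆ Finset.range k then MvPowerSeries.coeff d f else 0 := rfl

/-- Setting the variables `x_j`, `j ≥ k`, to zero. -/
def truncVars (k : ℕ) : MvPowerSeries ℕ ℚ →+* MvPowerSeries ℕ ℚ where
  toFun := truncVarsFun k
  map_one' := by
    classical
    ext d
    rw [coeff_truncVarsFun, MvPowerSeries.coeff_one]
    by_cases hd : d = 0
    · subst hd; simp
    · simp [hd]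
  map_mul' f g := by
    classical
    ext d
    rw [coeff_truncVarsFun, MvPowerSeries.coeff_mul, MvPowerSeries.coeff_mul]
    simp only [coeff_truncVarsFun]
    split_ifs with h
    · refine Finset.sum_congr rfl fun x hx => ?_
      rw [mem_antidiagonal] at hx
      rw [if_pos, if_pos]
      · exact (Finsupp.support_mono (hx ▸ le_add_self)).trans h
      · exact (Finsupp.support_mono (hx ▸ le_self_add)).trans h
    · symm
      refine Finset.sum_eq_zero fun x hx => ?_
      rw [mem_antidiagonal] at hx
      by_cases h1 : x.1.support ⊆ Finset.range k
      · rw [if_neg (c := x.2.support ⊆ _), mul_zero]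
        intro h2
        apply h
        rw [← hx]
        exact Finsupp.support_add.trans (Finset.union_subset h1 h2)
      · rw [if_neg h1, zero_mul]
  map_zero' := by ext d; rw [coeff_truncVarsFun]; simp
  map_add' f g := by
    ext d
    rw [map_add, coeff_truncVarsFun, coeff_truncVarsFun, coeff_truncVarsFun, map_add]
    split_ifs <;> simp

theorem coeff_truncVars (k : ℕ) (f : MvPowerSeries ℕ ℚ) (d : ℕ →₀ ℕ) :
    MvPowerSeries.coeff d (truncVars k f) =
      if d.support ⊆ Finset.range k then MvPowerSeries.coeff d f else 0 := rfl

/-- The sum of all monomials of degree `m`. -/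
def homogeneousSeries (m : ℤ) : MvPowerSeries ℕ ℚ := fun d => if (d.degree : ℤ) = m then 1 else 0

theorem coeff_homogeneousSeries (m : ℤ) (d : ℕ →₀ ℕ) :
    MvPowerSeries.coeff d (homogeneousSeries m) = if (d.degree : ℤ) = m then 1 else 0 := rfl

theorem homogeneousSeries_of_neg {m : ℤ} (hm : m < 0) : homogeneousSeries m = 0 := by
  ext d
  rw [coeff_homogeneousSeries, if_neg (by omega)]; simp

theorem homogeneousSeries_zero : homogeneousSeries 0 = 1 := by
  classical
  ext d
  rw [coeff_homogeneousSeries, MvPowerSeries.coeff_one]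
  refine if_congr ?_ rfl rfl
  rw [Nat.cast_eq_zero, Finsupp.degree_eq_zero_iff]

theorem coeff_X_pow_mul_truncated {k : ℕ} (e : ℕ) (f : MvPowerSeries ℕ ℚ) {d : ℕ →₀ ℕ}
    (hd : d.support ⊆ Finset.range (k + 1)) :
    MvPowerSeries.coeff d (MvPowerSeries.X k ^ e * truncVars k f) =
      if e = d k then MvPowerSeries.coeff (d.erase k) f else 0 := by
  classical
  rw [MvPowerSeries.X_pow_eq, MvPowerSeries.coeff_monomial_mul]
  have hsupp : ∀ c : ℕ →₀ ℕ, c ≤ d → (c.support ⊆ Finset.range k ↔ c k = 0) := by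
    intro c hc
    constructor
    · intro h
      by_contra h'
      simpa using h (Finsupp.mem_support_iff.mpr h')
    · intro h i hi
      have h1 := hd (Finsupp.support_mono hc hi)
      have h2 : i ≠ k := by rintro rfl; exact Finsupp.mem_support_iff.mp hi h
      simp only [Finset.mem_range] at h1 ⊢
      omega
  by_cases he : Finsupp.single k e ≤ d
  · rw [if_pos he, one_mul, coeff_truncVars, if_congr (hsupp _ tsub_le_self) rfl rfl]
    rw [Finsupp.single_le_iff] at he
    simp only [Finsupp.tsub_apply, Finsupp.single_eq_same]
    refine ite_congr (propext ⟨by omega, by omega⟩) (fun h => ?_) fun _ => rfl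
    congr 2
    ext i
    by_cases hi : i = k
    · subst hi; simp [h]
    · simp [hi]
  · rw [if_neg he, if_neg]
    rintro rfl
    exact he (Finsupp.single_le_iff.mpr le_rfl)

/-- The monomials of degree m divisible by x_k are x_k times those of degree m-1. This is the
relation between h and H that `sum_jacobiTrudi_interlacing` requires, with y = x_k. -/
theorem truncVars_homogeneousSeries_succ (k : ℕ) (m : ℤ) :
    truncVars k (homogeneousSeries m) = truncVars (k + 1) (homogeneousSeries m) -
      MvPowerSeries.X k * truncVars (k + 1) (homogeneousSeries (m - 1)) := by
  classical
  ext d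
  rw [map_sub, MvPowerSeries.X, MvPowerSeries.coeff_monomial_mul, coeff_truncVars, coeff_truncVars]
  by_cases hd : d.support ⊆ Finset.range (k + 1)
  · rw [if_pos hd]
    by_cases hk : Finsupp.single k 1 ≤ d
    · have hk' := Finsupp.single_le_iff.mp hk
      rw [if_neg, if_pos hk, coeff_truncVars, if_pos, one_mul, coeff_homogeneousSeries,
        coeff_homogeneousSeries, eq_comm, sub_eq_zero]
      · refine if_congr ?_ rfl rfl
        have : d.degree = (d - Finsupp.single k 1).degree + 1 := by
          conv_lhs => rw [← tsub_add_cancel_of_le hk, map_add, Finsupp.degree_single]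
        omega
      · exact (Finsupp.support_mono tsub_le_self).trans hd
      · intro h
        have := h (Finsupp.mem_support_iff.mpr (show d k ≠ 0 by omega))
        simp at this
    · rw [if_neg hk, sub_zero, if_pos]
      intro i hi
      have h1 := hd hi
      rw [Finset.mem_range] at h1 ⊢
      have h2 : i ≠ k := by
        rintro rfl
        exact hk (Finsupp.single_le_iff.mpr
          (Nat.one_le_iff_ne_zero.mpr (Finsupp.mem_support_iff.mp hi)))
      omega
  · rw [if_neg hd, if_neg fun h => hd (h.trans (Finset.range_mono (Nat.le_succ k)))]
    rw [zero_sub, eq_comm, neg_eq_zero]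
    split_ifs with hk
    · rw [coeff_truncVars, if_neg, mul_zero]
      intro h
      apply hd
      rw [← tsub_add_cancel_of_le hk]
      refine Finsupp.support_add.trans (Finset.union_subset h ?_)
      exact Finsupp.support_single_subset.trans (by simp)
    · rfl

/-- A factorization of x^d counted here is a choice of a variable x_t whose k-th power divides x^d.
-/
theorem coeff_psumSeries_mul_homogeneousSeries (k : ℕ+) (m : ℕ) (d : ℕ →₀ ℕ) :
    MvPowerSeries.coeff d (psumSeries k * homogeneousSeries m) =
      if d.degree = k + m then ((d.support.filter fun t => (k : ℕ) ≤ d t).card : ℚ) else 0 := by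
  classical
  have hp : ∀ a, MvPowerSeries.coeff a (psumSeries k) =
    if ∃ j : ℕ, a = Finsupp.single j (k : ℕ) then 1 else 0 := fun a => rfl
  have hk := k.pos
  rw [MvPowerSeries.coeff_mul]
  simp only [hp, coeff_homogeneousSeries, ite_mul, zero_mul, one_mul, ← ite_and]
  rw [Finset.sum_boole]
  have hdeg : ∀ a b : ℕ →₀ ℕ, a + b = d → ∀ t, a = Finsupp.single t (k : ℕ) →
      d.degree = k + b.degree := by
    rintro a b rfl t rfl
    simp
  split_ifs with hd
  · congr 1
    symm
    refine Finset.card_bij (fun t _ => (Finsupp.single t (k : ℕ), d - Finsupp.single t (k : ℕ)))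
      ?_ ?_ ?_
    · intro t ht
      have ht' := (Finset.mem_filter.mp ht).2
      have h1 : Finsupp.single t (k : ℕ) + (d - Finsupp.single t (k : ℕ)) = d :=
        add_tsub_cancel_of_le (Finsupp.single_le_iff.mpr ht')
      refine Finset.mem_filter.mpr ⟨mem_antidiagonal.mpr h1, ⟨t, rfl⟩, ?_⟩
      have := hdeg _ _ h1 t rfl
      simp only
      omega
    · intro t _ t' _ h
      exact Finsupp.single_left_injective hk.ne' (Prod.mk.inj h).1
    · rintro ⟨a, b⟩ hab
      obtain ⟨h1, ⟨t, h2⟩, h3⟩ := Finset.mem_filter.mp hab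
      rw [mem_antidiagonal] at h1
      simp only at h1 h2
      refine ⟨t, ?_, ?_⟩
      · have : (k : ℕ) ≤ d t := by rw [← h1, h2]; simp
        exact Finset.mem_filter.mpr ⟨Finsupp.mem_support_iff.mpr (by omega), this⟩
      · rw [← h2, ← h1, add_tsub_cancel_left]
  · rw [Nat.cast_eq_zero, Finset.card_eq_zero, Finset.filter_eq_empty_iff]
    rintro ⟨a, b⟩ hab ⟨⟨t, h2⟩, h3⟩
    rw [mem_antidiagonal] at hab
    have := hdeg a b hab t h2
    simp only at h3
    omega

theorem sum_range_ite_succ_le {c n : ℕ} (h : c ≤ n) :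
    (∑ i ∈ Finset.range n, if i + 1 ≤ c then 1 else 0) = c := by
  rw [← Finset.card_filter]
  conv_rhs => rw [← Finset.card_range c]
  congr 1
  ext i
  simp only [Finset.mem_filter, Finset.mem_range]
  omega

/-- The series of all monomials satisfies Newton's recursion in the form X f' = P f, with P the
series of power sums, and has constant term 1, which determines it. -/
theorem realize_hsym (n : ℕ) : realize (hsym n) = homogeneousSeries n := by
  classical
  have key : PowerSeries.map (realize : Sym →+* MvPowerSeries ℕ ℚ) hSeries -
      PowerSeries.mk (fun n : ℕ => homogeneousSeries n) = 0 := by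
    refine eq_zero_of_X_mul_derivative_eq
      (P := PowerSeries.map (realize : Sym →+* MvPowerSeries ℕ ℚ) pSeries) ?_ ?_ ?_
    · rw [PowerSeries.coeff_map, coeff_zero_pSeries, map_zero]
    · have h1 : PowerSeries.X * PowerSeries.derivative _
            (PowerSeries.map (realize : Sym →+* MvPowerSeries ℕ ℚ) hSeries) =
          PowerSeries.map (realize : Sym →+* _) pSeries *
            PowerSeries.map (realize : Sym →+* _) hSeries := by
        rw [← map_mul, ← X_mul_derivative_hSeries]
        ext1 n
        rw [coeff_X_mul_derivative, PowerSeries.coeff_map, PowerSeries.coeff_map,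
          coeff_X_mul_derivative, map_mul, map_natCast]
      rw [map_sub, mul_sub, mul_sub, h1]
      congr 1
      ext1 n
      rw [coeff_X_mul_derivative, PowerSeries.coeff_mul, PowerSeries.coeff_mk]
      cases n with
      | zero => simp [pSeries, psym]
      | succ n =>
        rw [Finset.Nat.antidiagonal_succ, Finset.sum_cons, Finset.sum_map]
        rw [PowerSeries.coeff_map, coeff_zero_pSeries, map_zero, zero_mul, zero_add]
        have h2 : ∀ x ∈ antidiagonal n,
            PowerSeries.coeff (x.1 + 1) (PowerSeries.map (realize : Sym →+* _) pSeries) *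
              PowerSeries.coeff x.2 (PowerSeries.mk (fun n : ℕ => homogeneousSeries n)) =
            psumSeries x.1.succPNat * homogeneousSeries x.2 := by
          intro x _
          rw [PowerSeries.coeff_map, PowerSeries.coeff_mk, pSeries, PowerSeries.coeff_mk]
          congr 1
          have := psym_coe x.1.succPNat
          rw [Nat.succPNat_coe] at this
          rw [Nat.succ_eq_add_one] at this
          rw [this]
          simp [realize]
        refine Eq.trans ?_ (Finset.sum_congr rfl fun x hx => (h2 x hx).symm)
        ext d
        rw [← nsmul_eq_mul, map_nsmul, map_sum]
        simp only [coeff_psumSeries_mul_homogeneousSeries, coeff_homogeneousSeries]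
        have h3 : ∀ x ∈ antidiagonal n,
            (if d.degree = (x.1.succPNat : ℕ) + x.2 then
              ((d.support.filter fun t => (x.1.succPNat : ℕ) ≤ d t).card : ℚ) else 0) =
            if d.degree = n + 1 then
              ((d.support.filter fun t => (x.1.succPNat : ℕ) ≤ d t).card : ℚ) else 0 := by
          intro x hx
          rw [mem_antidiagonal] at hx
          refine if_congr ?_ rfl rfl
          rw [Nat.succPNat_coe]
          omega
        rw [Finset.sum_congr rfl h3]
        by_cases hd : d.degree = n + 1
        · simp only [hd, if_true]
          rw [Finset.Nat.sum_antidiagonal_eq_sum_range_succ_mk]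
          simp only [Finset.card_filter]
          rw [← Nat.cast_sum, Finset.sum_comm]
          -- Summing over i the number of t with d t > i counts every variable as often as its
          -- exponent, giving the degree n + 1.
          have h4 : ∀ t ∈ d.support,
              (∑ i ∈ Finset.range n.succ, if (i.succPNat : ℕ) ≤ d t then 1 else 0) = d t := by
            intro t _
            have h5 : d t ≤ n + 1 := hd ▸ Finsupp.le_degree t d
            exact sum_range_ite_succ_le h5
          rw [Finset.sum_congr rfl h4]
          have h6 : ∑ t ∈ d.support, d t = n + 1 := hd
          rw [h6]
          simp
        · have : ¬ ((d.degree : ℤ) = ((n + 1 : ℕ) : ℤ)) := by exact_mod_cast hd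
          rw [if_neg this]
          simp [hd]
    · rw [map_sub, PowerSeries.coeff_map]
      simp [hSeries, hsym_zero, homogeneousSeries_zero]
  have := congrArg (PowerSeries.coeff n) key
  rw [map_sub, PowerSeries.coeff_map, PowerSeries.coeff_mk, hSeries, PowerSeries.coeff_mk,
    map_zero, sub_eq_zero] at this
  exact this

theorem realize_hZ (m : ℤ) : realize (hZ m) = homogeneousSeries m := by
  rcases lt_or_ge m 0 with hm | hm
  · rw [hZ_of_neg hm, homogeneousSeries_of_neg hm, map_zero]
  · lift m to ℕ using hm
    rw [hZ_natCast, realize_hsym]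

/-! ### Removing the largest entry from a tableau -/

/-- Tableaux with row lengths `a` and content `d`, as functions vanishing outside the diagram. -/
structure IsTableau {r : ℕ} (a : Fin r → ℕ) (d : ℕ →₀ ℕ) (T : Fin r → ℕ → ℕ) : Prop where
  row_weak : ∀ i j j', j ≤ j' → j' < a i → T i j ≤ T i j'
  col_strict : ∀ i i' j, i < i' → j < a i' → T i j < T i' j
  zeros : ∀ i j, a i ≤ j → T i j = 0
  content_eq : ∑ i, ∑ j ∈ Finset.range (a i), Finsupp.single (T i j) 1 = d

theorem IsTableau.mem_support {r : ℕ} {a : Fin r → ℕ} {d : ℕ →₀ ℕ} {T : Fin r → ℕ → ℕ}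
    (hT : IsTableau a d T) {i : Fin r} {j : ℕ} (hj : j < a i) : T i j ∈ d.support := by
  rw [Finsupp.mem_support_iff, ← hT.content_eq, Finsupp.finsetSum_apply]
  have h1 : (Finsupp.single (T i j) 1 : ℕ →₀ ℕ) (T i j) ≤
      (∑ j' ∈ Finset.range (a i), Finsupp.single (T i j') 1 : ℕ →₀ ℕ) (T i j) := by
    rw [Finsupp.finsetSum_apply]
    exact Finset.single_le_sum (f := fun j' => (Finsupp.single (T i j') 1 : ℕ →₀ ℕ) (T i j))
      (fun _ _ => Nat.zero_le _) (Finset.mem_range.mpr hj)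
  have h2 := Finset.single_le_sum
    (f := fun i' => (∑ j' ∈ Finset.range (a i'), Finsupp.single (T i' j') 1 : ℕ →₀ ℕ) (T i j))
    (fun _ _ => Nat.zero_le _) (Finset.mem_univ i)
  rw [Finsupp.single_eq_same] at h1
  omega

instance finite_isTableau {r : ℕ} (a : Fin r → ℕ) (d : ℕ →₀ ℕ) :
    Finite {T // IsTableau a d T} := by
  refine Finite.of_injective (β := (c : Σ i, Fin (a i)) → d.support)
    (fun T c => ⟨T.1 c.1 c.2, T.2.mem_support c.2.2⟩) ?_
  intro T T' h
  ext i j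
  by_cases hj : j < a i
  · have := congrFun h ⟨i, j, hj⟩
    simpa using this
  · rw [T.2.zeros i j (not_lt.mp hj), T'.2.zeros i j (not_lt.mp hj)]

/-- The shape formed by the entries less than `k`. -/
def lowerShape {r : ℕ} (a : Fin r → ℕ) (k : ℕ) (T : Fin r → ℕ → ℕ) (i : Fin r) : ℕ :=
  ((Finset.range (a i)).filter fun j => T i j < k).card

theorem lowerShape_le {r : ℕ} (a : Fin r → ℕ) (k : ℕ) (T : Fin r → ℕ → ℕ) (i : Fin r) :
    lowerShape a k T i ≤ a i := by
  simpa [lowerShape] using Finset.card_filter_le (Finset.range (a i)) fun j => T i j < k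

theorem filter_range_lt_eq_range {m k : ℕ} {t : ℕ → ℕ}
    (ht : ∀ j j', j ≤ j' → j' < m → t j ≤ t j') :
    ((Finset.range m).filter fun j => t j < k) =
      Finset.range ((Finset.range m).filter fun j => t j < k).card := by
  induction m with
  | zero => simp
  | succ m ih =>
    have ih' := ih fun j j' h1 h2 => ht j j' h1 (by omega)
    by_cases hm : t m < k
    · have : ((Finset.range (m + 1)).filter fun j => t j < k) = Finset.range (m + 1) := by
        refine Finset.filter_true_of_mem fun j hj => ?_
        rw [Finset.mem_range] at hj
        exact lt_of_le_of_lt (ht j m (by omega) (by omega)) hm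
      rw [this, Finset.card_range]
    · rw [Finset.range_add_one, Finset.filter_insert, if_neg hm]
      exact ih'

theorem IsTableau.lt_lowerShape_iff {r : ℕ} {a : Fin r → ℕ} {d : ℕ →₀ ℕ} {T : Fin r → ℕ → ℕ}
    (hT : IsTableau a d T) (k : ℕ) {i : Fin r} {j : ℕ} :
    j < lowerShape a k T i ↔ j < a i ∧ T i j < k := by
  have := filter_range_lt_eq_range (k := k) (hT.row_weak i)
  rw [Finset.ext_iff] at this
  rw [← Finset.mem_range, lowerShape, ← this]
  simp

theorem nextEntry_of_lt {r : ℕ} {a : Fin r → ℕ} (ha : Antitone a) {i i' : Fin r} (h : i < i') :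
    a i' ≤ nextEntry a i := by
  have h1 : (i : ℕ) + 1 < r := lt_of_le_of_lt (Fin.lt_def.mp h) i'.2
  rw [nextEntry, dif_pos h1]
  exact ha (Fin.le_def.mpr h)

/-- The cells holding the largest possible entry k form a horizontal strip: a cell directly below
one of them would need an entry larger than k. -/
theorem lowerShape_mem {r : ℕ} {a : Fin r → ℕ} (ha : Antitone a) {d : ℕ →₀ ℕ} {k : ℕ}
    (hd : d.support ⊆ Finset.range (k + 1)) {T : Fin r → ℕ → ℕ} (hT : IsTableau a d T) :
    lowerShape a k T ∈ Fintype.piFinset fun i => Finset.Icc (nextEntry a i) (a i) := by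
  rw [Fintype.mem_piFinset]
  refine fun i => Finset.mem_Icc.mpr ⟨?_, lowerShape_le a k T i⟩
  unfold nextEntry
  split_ifs with h
  · by_contra hc
    push Not at hc
    have h1 := hT.col_strict i ⟨i + 1, h⟩ _ (Fin.lt_def.mpr (Nat.lt_succ_self _)) hc
    have h2 := hd (hT.mem_support hc)
    rw [Finset.mem_range] at h2
    have h3 := (hT.lt_lowerShape_iff k (i := i) (j := lowerShape a k T i)).not.mp (lt_irrefl _)
    have h5 : a ⟨i + 1, h⟩ ≤ a i := ha (Fin.le_def.mpr (Nat.le_succ _))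
    exact h3 ⟨by omega, by omega⟩
  · exact Nat.zero_le _

/-- Remove all cells outside the shape `b`. -/
def cutTableau {r : ℕ} (b : Fin r → ℕ) (T : Fin r → ℕ → ℕ) (i : Fin r) (j : ℕ) : ℕ :=
  if j < b i then T i j else 0

/-- Fill the cells of `a` outside `b` with `k`. -/
def fillTableau {r : ℕ} (a b : Fin r → ℕ) (k : ℕ) (T : Fin r → ℕ → ℕ) (i : Fin r) (j : ℕ) : ℕ :=
  if j < b i then T i j else if j < a i then k else 0

theorem sum_range_single_split {m n k : ℕ} (h : m ≤ n) {t t' : ℕ → ℕ} (h1 : ∀ j < m, t j = t' j)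
    (h2 : ∀ j, m ≤ j → j < n → t j = k) :
    ∑ j ∈ Finset.range n, (Finsupp.single (t j) 1 : ℕ →₀ ℕ) =
      ∑ j ∈ Finset.range m, Finsupp.single (t' j) 1 + Finsupp.single k (n - m) := by
  rw [Finset.range_eq_Ico, ← Finset.sum_Ico_consecutive _ (Nat.zero_le m) h,
    ← Finset.range_eq_Ico]
  congr 1
  · exact Finset.sum_congr rfl fun j hj => by rw [h1 j (Finset.mem_range.mp hj)]
  · have : ∀ j ∈ Finset.Ico m n, (Finsupp.single (t j) 1 : ℕ →₀ ℕ) = Finsupp.single k 1 := by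
      intro j hj
      rw [Finset.mem_Ico] at hj
      rw [h2 j hj.1 hj.2]
    rw [Finset.sum_congr rfl this]
    simp

theorem IsTableau.content_eq_add {r : ℕ} {a : Fin r → ℕ} {d : ℕ →₀ ℕ} {k : ℕ}
    (hd : d.support ⊆ Finset.range (k + 1)) {T : Fin r → ℕ → ℕ} (hT : IsTableau a d T) :
    d = ∑ i, ∑ j ∈ Finset.range (lowerShape a k T i),
        Finsupp.single (cutTableau (lowerShape a k T) T i j) 1 +
      Finsupp.single k (∑ i, (a i - lowerShape a k T i)) := by
  conv_lhs => rw [← hT.content_eq]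
  rw [Finsupp.single_finsetSum, ← Finset.sum_add_distrib]
  refine Finset.sum_congr rfl fun i _ => sum_range_single_split (lowerShape_le a k T i) ?_ ?_
  · intro j hj
    rw [cutTableau, if_pos hj]
  · intro j hj hj'
    have h1 := (hT.lt_lowerShape_iff k).not.mp (not_lt.mpr hj)
    have h2 := hd (hT.mem_support hj')
    rw [Finset.mem_range] at h2
    by_contra h3
    exact h1 ⟨hj', by omega⟩

theorem cutTableau_content_apply {r : ℕ} {a : Fin r → ℕ} {d : ℕ →₀ ℕ} (k : ℕ)
    {T : Fin r → ℕ → ℕ} (hT : IsTableau a d T) :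
    (∑ i, ∑ j ∈ Finset.range (lowerShape a k T i),
        Finsupp.single (cutTableau (lowerShape a k T) T i j) 1 : ℕ →₀ ℕ) k = 0 := by
  rw [Finsupp.finsetSum_apply]
  refine Finset.sum_eq_zero fun i _ => ?_
  rw [Finsupp.finsetSum_apply]
  refine Finset.sum_eq_zero fun j hj => ?_
  rw [Finset.mem_range] at hj
  rw [cutTableau, if_pos hj, Finsupp.single_apply, if_neg]
  exact ((hT.lt_lowerShape_iff k).mp hj).2.ne

theorem IsTableau.cut {r : ℕ} {a : Fin r → ℕ} {d : ℕ →₀ ℕ} {k : ℕ}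
    (hd : d.support ⊆ Finset.range (k + 1)) {T : Fin r → ℕ → ℕ} (hT : IsTableau a d T) :
    IsTableau (lowerShape a k T) (d.erase k) (cutTableau (lowerShape a k T) T) where
  row_weak i j j' h1 h2 := by
    rw [cutTableau, cutTableau, if_pos h2, if_pos (lt_of_le_of_lt h1 h2)]
    exact hT.row_weak i j j' h1 ((hT.lt_lowerShape_iff k).mp h2).1
  col_strict i i' j h1 h2 := by
    have h3 := (hT.lt_lowerShape_iff k).mp h2
    have h4 := hT.col_strict i i' j h1 h3.1
    rw [cutTableau, cutTableau, if_pos h2]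
    split_ifs with h5
    · exact h4
    · omega
  zeros i j h := by rw [cutTableau, if_neg (not_lt.mpr h)]
  content_eq := by
    have h1 := hT.content_eq_add hd
    have h2 := cutTableau_content_apply k hT
    conv_rhs => rw [h1]
    rw [Finsupp.erase_add, Finsupp.erase_single, add_zero, Finsupp.erase_of_notMem_support]
    rw [Finsupp.notMem_support_iff]
    exact h2

theorem IsTableau.sum_sub_lowerShape {r : ℕ} {a : Fin r → ℕ} {d : ℕ →₀ ℕ} {k : ℕ}
    (hd : d.support ⊆ Finset.range (k + 1)) {T : Fin r → ℕ → ℕ} (hT : IsTableau a d T) :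
    ∑ i, (a i - lowerShape a k T i) = d k := by
  have h1 := hT.content_eq_add hd
  have h2 := cutTableau_content_apply k hT
  have h3 := DFunLike.congr_fun h1 k
  rw [Finsupp.add_apply, h2, Finsupp.single_eq_same, zero_add] at h3
  exact h3.symm

theorem IsTableau.fill {r : ℕ} {a b : Fin r → ℕ} (ha : Antitone a) {d : ℕ →₀ ℕ} {k : ℕ}
    (hd : d.support ⊆ Finset.range (k + 1))
    (hb : b ∈ Fintype.piFinset fun i => Finset.Icc (nextEntry a i) (a i))
    (hk : ∑ i, (a i - b i) = d k) {T : Fin r → ℕ → ℕ} (hT : IsTableau b (d.erase k) T) :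
    IsTableau a d (fillTableau a b k T) := by
  have hb' : ∀ i, nextEntry a i ≤ b i ∧ b i ≤ a i := fun i =>
    Finset.mem_Icc.mp (Fintype.mem_piFinset.mp hb i)
  have hlt : ∀ i j, j < b i → T i j < k := by
    intro i j hj
    have h := hT.mem_support hj
    rw [Finsupp.support_erase, Finset.mem_erase] at h
    have h2 := hd h.2
    rw [Finset.mem_range] at h2
    omega
  refine ⟨fun i j j' h1 h2 => ?_, fun i i' j h1 h2 => ?_, fun i j h => ?_, ?_⟩
  · unfold fillTableau
    rw [if_pos h2, if_pos (lt_of_le_of_lt h1 h2)]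
    split_ifs with h3 h4 h4
    · exact hT.row_weak i j j' h1 h4
    · exact (hlt i j h3).le
    · omega
    · exact le_rfl
  · have h3 := nextEntry_of_lt ha h1
    have h4 := hb' i
    unfold fillTableau
    rw [if_pos (by omega), if_pos h2]
    split_ifs with h5
    · exact hT.col_strict i i' j h1 h5
    · exact hlt i j (by omega)
  · have := hb' i
    rw [fillTableau, if_neg (by omega), if_neg (by omega)]
  · have h1 : ∀ i, ∑ j ∈ Finset.range (a i),
        (Finsupp.single (fillTableau a b k T i j) 1 : ℕ →₀ ℕ) =
        ∑ j ∈ Finset.range (b i), Finsupp.single (T i j) 1 + Finsupp.single k (a i - b i) := by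
      intro i
      refine sum_range_single_split (hb' i).2 ?_ ?_
      · intro j hj
        rw [fillTableau, if_pos hj]
      · intro j hj hj'
        rw [fillTableau, if_neg (not_lt.mpr hj), if_pos hj']
    rw [Finset.sum_congr rfl fun i _ => h1 i, Finset.sum_add_distrib, hT.content_eq,
      ← Finsupp.single_finsetSum, hk]
    exact Finsupp.erase_add_single k d

theorem lowerShape_fillTableau {r : ℕ} {a b : Fin r → ℕ} {d : ℕ →₀ ℕ} {k : ℕ}
    (hd : d.support ⊆ Finset.range (k + 1)) (hb : ∀ i, b i ≤ a i) {T : Fin r → ℕ → ℕ}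
    (hT : IsTableau b (d.erase k) T) : lowerShape a k (fillTableau a b k T) = b := by
  ext i
  rw [lowerShape]
  conv_rhs => rw [← Finset.card_range (b i)]
  congr 1
  ext j
  have := hb i
  rw [Finset.mem_filter, Finset.mem_range, Finset.mem_range, fillTableau]
  constructor
  · rintro ⟨h1, h2⟩
    by_contra h3
    rw [if_neg h3, if_pos h1] at h2
    exact lt_irrefl _ h2
  · intro h
    have h' := hT.mem_support h
    rw [Finsupp.support_erase, Finset.mem_erase] at h'
    have h2 := hd h'.2
    rw [Finset.mem_range] at h2
    rw [if_pos h]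
    omega

/-- Branching: removing the largest entry from a tableau. -/
theorem card_isTableau_branching {r : ℕ} {a : Fin r → ℕ} (ha : Antitone a) {d : ℕ →₀ ℕ} {k : ℕ}
    (hd : d.support ⊆ Finset.range (k + 1)) :
    Nat.card {T // IsTableau a d T} =
      ∑ b ∈ Fintype.piFinset fun i => Finset.Icc (nextEntry a i) (a i),
        if ∑ i, (a i - b i) = d k then Nat.card {T // IsTableau b (d.erase k) T} else 0 := by
  let S := Fintype.piFinset fun i => Finset.Icc (nextEntry a i) (a i)
  let f : {T // IsTableau a d T} → S := fun T => ⟨lowerShape a k T.1, lowerShape_mem ha hd T.2⟩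
  rw [Nat.card_congr (Equiv.sigmaFiberEquiv f).symm, Nat.card_sigma]
  refine Eq.trans ?_ (Finset.sum_coe_sort S fun b =>
    if ∑ i, (a i - b i) = d k then Nat.card {T // IsTableau b (d.erase k) T} else 0)
  refine Finset.sum_congr rfl fun b _ => ?_
  have hb : ∀ i, (b : Fin r → ℕ) i ≤ a i := fun i =>
    (Finset.mem_Icc.mp (Fintype.mem_piFinset.mp b.2 i)).2
  split_ifs with hk
  · refine Nat.card_congr
      { toFun := fun T => ⟨cutTableau b T.1.1, ?_⟩
        invFun := fun T => ⟨⟨fillTableau a b k T.1, T.2.fill ha hd b.2 hk⟩, ?_⟩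
        left_inv := ?_
        right_inv := ?_ }
    · have h : lowerShape a k T.1.1 = b := congrArg Subtype.val T.2
      rw [← h]
      exact T.1.2.cut hd
    · exact Subtype.ext (lowerShape_fillTableau hd hb T.2)
    · rintro ⟨⟨T, hT⟩, hTb⟩
      have h : lowerShape a k T = b := congrArg Subtype.val hTb
      refine Subtype.ext (Subtype.ext ?_)
      ext i j
      simp only [fillTableau, cutTableau]
      have h1 := hT.lt_lowerShape_iff k (i := i) (j := j)
      rw [h] at h1
      split_ifs with h2 h3
      · rfl
      · have h4 := hd (hT.mem_support h3)
        rw [Finset.mem_range] at h4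
        by_contra h5
        exact h2 (h1.mpr ⟨h3, by omega⟩)
      · exact (hT.zeros i j (not_lt.mp h3)).symm
    · rintro ⟨T, hT⟩
      refine Subtype.ext ?_
      ext i j
      simp only [fillTableau, cutTableau]
      split_ifs with h2
      · rfl
      · exact (hT.zeros i j (not_lt.mp h2)).symm
  · rw [Nat.card_eq_zero]
    left
    refine ⟨fun T => hk ?_⟩
    have h : lowerShape a k T.1.1 = b := congrArg Subtype.val T.2
    rw [← h]
    exact T.1.2.sum_sub_lowerShape hd

theorem antitone_of_mem_interlacing {r : ℕ} {a b : Fin r → ℕ} (ha : Antitone a)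
    (hb : b ∈ Fintype.piFinset fun i => Finset.Icc (nextEntry a i) (a i)) : Antitone b := by
  have hb' : ∀ i, nextEntry a i ≤ b i ∧ b i ≤ a i := fun i =>
    Finset.mem_Icc.mp (Fintype.mem_piFinset.mp hb i)
  intro i j hij
  rcases hij.eq_or_lt with rfl | h
  · exact le_rfl
  · exact (hb' j).2.trans ((nextEntry_of_lt ha h).trans (hb' i).1)

/-! ### The Jacobi–Trudi identity for Schur series -/

theorem truncVars_jacobiTrudi (k : ℕ) {r : ℕ} (a : Fin r → ℤ) :
    truncVars k (jacobiTrudi homogeneousSeries a) =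
      jacobiTrudi (fun m => truncVars k (homogeneousSeries m)) a :=
  map_jacobiTrudi _ _ _

/-- This is the case of no variables. The empty shape gives the identity matrix and one tableau; any
other shape has a positive first row length, so the first matrix row vanishes and no tableau exists.
-/
theorem coeff_zero_jacobiTrudi {r : ℕ} {a : Fin r → ℕ} (ha : Antitone a) :
    MvPowerSeries.coeff 0 (jacobiTrudi homogeneousSeries fun i => (a i : ℤ)) =
      Nat.card {T // IsTableau a 0 T} := by
  have h0 : ∀ m : ℤ, MvPowerSeries.constantCoeff (homogeneousSeries m) = if m = 0 then 1 else 0 := by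
    intro m
    rw [← MvPowerSeries.coeff_zero_eq_constantCoeff_apply, coeff_homogeneousSeries]
    simp [eq_comm]
  rw [MvPowerSeries.coeff_zero_eq_constantCoeff_apply, map_jacobiTrudi]
  simp only [h0]
  by_cases h : ∀ i, a i = 0
  · have h1 : Nat.card {T // IsTableau a 0 T} = 1 := by
      rw [Nat.card_eq_one_iff_unique]
      refine ⟨⟨fun T T' => Subtype.ext ?_⟩, ⟨⟨fun _ _ => 0, ?_⟩⟩⟩
      · ext i j
        rw [T.2.zeros i j (by simp [h]), T'.2.zeros i j (by simp [h])]
      · exact ⟨by simp, fun i i' j _ hj => by simp [h] at hj, by simp, by simp [h]⟩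
    rw [h1, jacobiTrudi]
    have : (Matrix.of fun i j : Fin r =>
        if ((a i : ℕ) : ℤ) - (i : ℕ) + (j : ℕ) = 0 then (1 : ℚ) else 0) = 1 := by
      ext i j
      rw [Matrix.of_apply, Matrix.one_apply, h]
      refine if_congr ?_ rfl rfl
      rw [Fin.ext_iff]
      push_cast
      omega
    rw [this]
    simp
  · push Not at h
    obtain ⟨i, hi⟩ := h
    have h1 : Nat.card {T // IsTableau a 0 T} = 0 := by
      rw [Nat.card_eq_zero]
      left
      refine ⟨fun T => ?_⟩
      have := T.2.mem_support (i := i) (j := 0) (Nat.pos_of_ne_zero hi)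
      simp at this
    rw [h1, jacobiTrudi, Matrix.det_eq_zero_of_row_eq_zero ⟨0, i.pos⟩]
    · simp
    · intro j
      have : a i ≤ a ⟨0, i.pos⟩ := ha (Fin.le_def.mpr (Nat.zero_le _))
      rw [Matrix.of_apply, if_neg]
      simp only
      push_cast
      omega

/-- The Jacobi–Trudi identity. -/
theorem coeff_jacobiTrudi (k : ℕ) {r : ℕ} {a : Fin r → ℕ} (ha : Antitone a) {d : ℕ →₀ ℕ}
    (hd : d.support ⊆ Finset.range k) :
    MvPowerSeries.coeff d (jacobiTrudi homogeneousSeries fun i => (a i : ℤ)) =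
      Nat.card {T // IsTableau a d T} := by
  induction k generalizing r a d with
  | zero =>
    have : d = 0 := by
      rw [← Finsupp.support_eq_empty]
      simpa using hd
    subst this
    exact coeff_zero_jacobiTrudi ha
  | succ k ih =>
    have h1 : MvPowerSeries.coeff d (jacobiTrudi homogeneousSeries fun i => (a i : ℤ)) =
        MvPowerSeries.coeff d
          (truncVars (k + 1) (jacobiTrudi homogeneousSeries fun i => (a i : ℤ))) := by
      rw [coeff_truncVars, if_pos hd]
    have hneg : ∀ m < 0, truncVars (k + 1) (homogeneousSeries m) = 0 := fun m hm => by
      rw [homogeneousSeries_of_neg hm, map_zero]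
    -- Removing the variable x_k from the determinant and the entry k from the tableaux gives sums
    -- over the same interlacing shapes, which are compared term by term.
    rw [h1, truncVars_jacobiTrudi,
      ← sum_jacobiTrudi_interlacing (truncVars_homogeneousSeries_succ k) hneg ha, map_sum,
      card_isTableau_branching ha hd, Nat.cast_sum]
    refine Finset.sum_congr rfl fun b hb => ?_
    rw [← truncVars_jacobiTrudi, coeff_X_pow_mul_truncated _ _ hd, Nat.cast_ite, Nat.cast_zero]
    refine ite_congr rfl (fun _ => ?_) fun _ => rfl
    refine ih (antitone_of_mem_interlacing ha hb) ?_
    intro i hi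
    rw [Finsupp.support_erase, Finset.mem_erase] at hi
    have := hd hi.2
    rw [Finset.mem_range] at this ⊢
    omega

/-- The row lengths of a partition, indexed from `0`. -/
def rows {N : ℕ} (θ : N.Partition) (i : ℕ) : ℕ := (partsList θ).getD i 0

theorem length_partsList {N : ℕ} (θ : N.Partition) : (partsList θ).length = length θ := by
  simp [partsList, length]

theorem coe_partsList {N : ℕ} (θ : N.Partition) : (partsList θ : Multiset ℕ) = θ.parts :=
  Multiset.sort_eq _ _

theorem rows_eq_zero {N : ℕ} (θ : N.Partition) {i : ℕ} (h : length θ ≤ i) : rows θ i = 0 := by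
  rw [rows, List.getD_eq_default]
  rwa [length_partsList]

theorem rows_pos {N : ℕ} (θ : N.Partition) {i : ℕ} (h : i < length θ) : 0 < rows θ i := by
  rw [← length_partsList] at h
  rw [rows, List.getD_eq_getElem _ _ h]
  refine θ.parts_pos ?_
  rw [← coe_partsList]
  exact List.getElem_mem h

theorem rows_antitone {N : ℕ} (θ : N.Partition) : Antitone (rows θ) := by
  intro i j hij
  rcases lt_or_ge j (length θ) with hj | hj
  · rw [← length_partsList] at hj
    rw [rows, rows, List.getD_eq_getElem _ _ hj, List.getD_eq_getElem _ _ (hij.trans_lt hj)]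
    have h := Multiset.pairwise_sort θ.parts (· ≥ ·)
    rcases hij.eq_or_lt with rfl | h'
    · exact le_rfl
    · exact List.pairwise_iff_getElem.mp h i j _ hj h'
  · rw [rows_eq_zero θ hj]; exact Nat.zero_le _

theorem rows_injective {N : ℕ} {θ η : N.Partition} (h : rows θ = rows η) : θ = η := by
  have hlen : length θ = length η := by
    rcases lt_trichotomy (length θ) (length η) with h1 | h1 | h1
    · have h2 := rows_pos η h1
      rw [← h, rows_eq_zero θ le_rfl] at h2
      exact absurd h2 (lt_irrefl _)
    · exact h1
    · have h2 := rows_pos θ h1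
      rw [h, rows_eq_zero η le_rfl] at h2
      exact absurd h2 (lt_irrefl _)
  have : partsList θ = partsList η := by
    refine List.ext_getElem (by rw [length_partsList, length_partsList, hlen]) fun i h1 h2 => ?_
    have := congrFun h i
    rwa [rows, rows, List.getD_eq_getElem _ _ h1, List.getD_eq_getElem _ _ h2] at this
  rw [Nat.Partition.ext_iff, ← coe_partsList, ← coe_partsList, this]

theorem mem_diagram {N : ℕ} (θ : N.Partition) {i j : ℕ} :
    (i, j) ∈ diagram θ ↔ j < rows θ i := by
  refine YoungDiagram.mem_ofRowLens.trans ?_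
  change (∃ h : i < (partsList θ).length, j < (partsList θ)[i]) ↔ _
  rw [rows]
  constructor
  · rintro ⟨h1, h2⟩
    rwa [List.getD_eq_getElem _ _ h1]
  · intro h
    rcases lt_or_ge i (partsList θ).length with h1 | h1
    · exact ⟨h1, by rwa [List.getD_eq_getElem _ _ h1] at h⟩
    · rw [List.getD_eq_default _ _ h1] at h
      exact absurd h (Nat.not_lt_zero _)

theorem sum_diagram_cells {M : Type*} [AddCommMonoid M] {N : ℕ} (θ : N.Partition) {r : ℕ}
    (hr : length θ ≤ r) (f : ℕ → ℕ → M) :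
    ∑ c ∈ (diagram θ).cells, f c.1 c.2 =
      ∑ i ∈ Finset.range r, ∑ j ∈ Finset.range (rows θ i), f i j := by
  rw [Finset.sum_sigma']
  refine Finset.sum_bij' (fun c _ => ⟨c.1, c.2⟩) (fun c _ => (c.1, c.2)) ?_ ?_ ?_ ?_ ?_
  · rintro ⟨i, j⟩ hc
    rw [YoungDiagram.mem_cells, mem_diagram] at hc
    simp only [Finset.mem_sigma, Finset.mem_range]
    refine ⟨?_, hc⟩
    by_contra h
    rw [rows_eq_zero θ (by omega)] at hc
    omega
  · rintro ⟨i, j⟩ hc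
    simp only [Finset.mem_sigma, Finset.mem_range] at hc
    rw [YoungDiagram.mem_cells, mem_diagram]
    exact hc.2
  · intros; rfl
  · intros; rfl
  · intros; rfl

/-- Permitting r to exceed the number of parts lets partitions of different lengths share one tuple
size. -/
theorem card_tableaux_eq {N : ℕ} (θ : N.Partition) {r : ℕ} (hr : length θ ≤ r) (d : ℕ →₀ ℕ) :
    Nat.card {T : SemistandardYoungTableau (diagram θ) // content T = d} =
      Nat.card {T // IsTableau (fun i : Fin r => rows θ i) d T} := by
  have hz : ∀ {i j}, j < rows θ i → i < r := by
    intro i j h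
    by_contra hc
    rw [rows_eq_zero θ (by omega)] at h
    omega
  refine Nat.card_congr
    { toFun := fun T => ⟨fun i j => T.1 i j, ?_, ?_, ?_, ?_⟩
      invFun := fun T => ⟨⟨fun i j => if h : i < r then T.1 ⟨i, h⟩ j else 0, ?_, ?_, ?_⟩, ?_⟩
      left_inv := ?_
      right_inv := ?_ }
  · intro i j j' h1 h2
    exact T.1.row_weak_of_le h1 ((mem_diagram θ).mpr h2)
  · intro i i' j h1 h2
    exact T.1.col_strict (Fin.lt_def.mp h1) ((mem_diagram θ).mpr h2)
  · intro i j h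
    exact T.1.zeros ((mem_diagram θ).not.mpr (not_lt.mpr h))
  · refine Eq.trans ?_ T.2
    rw [content, sum_diagram_cells θ hr fun i j => Finsupp.single (T.1 i j) 1, Finset.sum_range]
  · intro i j j' h1 h2
    rw [mem_diagram] at h2
    rw [dif_pos (hz h2), dif_pos (hz h2)]
    exact T.2.row_weak _ _ _ h1.le h2
  · intro i i' j h1 h2
    rw [mem_diagram] at h2
    rw [dif_pos (hz h2), dif_pos (h1.trans (hz h2))]
    exact T.2.col_strict _ _ _ (Fin.lt_def.mpr h1) h2
  · intro i j h
    rw [mem_diagram, not_lt] at h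
    split_ifs with h1
    · exact T.2.zeros _ _ h
    · rfl
  · refine Eq.trans ?_ T.2.content_eq
    change ∑ c ∈ (diagram θ).cells,
      Finsupp.single ((fun i j => if h : i < r then T.1 ⟨i, h⟩ j else 0) c.1 c.2) 1 = _
    rw [sum_diagram_cells θ hr fun i j =>
      Finsupp.single ((fun i j => if h : i < r then T.1 ⟨i, h⟩ j else 0) i j) 1, Finset.sum_range]
    simp
  · rintro ⟨T, hT⟩
    refine Subtype.ext ?_
    ext i j
    change (if h : i < r then T i j else 0) = T i j
    split_ifs with h
    · rfl
    · exact (T.zeros ((mem_diagram θ).not.mpr fun h' => h (hz h'))).symm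
  · rintro ⟨T, hT⟩
    refine Subtype.ext ?_
    ext i j
    change (if h : (i : ℕ) < r then T ⟨i, h⟩ j else 0) = T i j
    rw [dif_pos i.2]

theorem schurSeries_eq_jacobiTrudi {N : ℕ} (θ : N.Partition) {r : ℕ} (hr : length θ ≤ r) :
    schurSeries θ = jacobiTrudi homogeneousSeries fun i : Fin r => (rows θ i : ℤ) := by
  ext d
  have hd : d.support ⊆ Finset.range (d.support.sup id + 1) := fun i hi =>
    Finset.mem_range.mpr (Nat.lt_succ_of_le (Finset.le_sup (f := id) hi))
  have ha : Antitone fun i : Fin r => rows θ i := fun i j hij => rows_antitone θ hij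
  rw [coeff_jacobiTrudi _ ha hd, ← card_tableaux_eq θ hr]
  rfl

theorem realize_jacobiTrudi {N : ℕ} (θ : N.Partition) {r : ℕ} (hr : length θ ≤ r) :
    realize (jacobiTrudi hZ fun i : Fin r => (rows θ i : ℤ)) = schurSeries θ := by
  rw [schurSeries_eq_jacobiTrudi θ hr]
  refine (map_jacobiTrudi (realize : Sym →+* MvPowerSeries ℕ ℚ) hZ _).trans ?_
  congr 1
  funext m
  exact realize_hZ m

/-! ### Linear independence of the Schur series -/

theorem content_highestWeight_apply {N : ℕ} (θ : N.Partition) (v : ℕ) :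
    content (SemistandardYoungTableau.highestWeight (diagram θ)) v = rows θ v := by
  classical
  have h : content (SemistandardYoungTableau.highestWeight (diagram θ)) =
      ∑ c ∈ (diagram θ).cells, Finsupp.single c.1 1 := by
    refine Finset.sum_congr rfl fun c hc => ?_
    rw [SemistandardYoungTableau.highestWeight_apply, if_pos ((YoungDiagram.mem_cells _).mp hc)]
  rw [h, sum_diagram_cells θ (le_max_left (length θ) (v + 1)) fun i _ => Finsupp.single i 1,
    Finsupp.finsetSum_apply, Finset.sum_eq_single v]
  · simp
  · intro i _ hi
    simp [hi]
  · intro h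
    exact absurd (Finset.mem_range.mpr (lt_max_of_lt_right (Nat.lt_succ_self v))) h

theorem le_tableau_entry {μ : YoungDiagram} (T : SemistandardYoungTableau μ) {i j : ℕ}
    (h : (i, j) ∈ μ) : i ≤ T i j := by
  induction i with
  | zero => exact Nat.zero_le _
  | succ i ih =>
    have h1 := ih (μ.up_left_mem (Nat.le_succ i) le_rfl h)
    have h2 := T.col_strict (Nat.lt_succ_self i) h
    rw [Nat.succ_eq_add_one] at h2
    omega

theorem sum_content {μ : YoungDiagram} (T : SemistandardYoungTableau μ) :
    (content T).sum (fun v m => m * v) = ∑ c ∈ μ.cells, T c.1 c.2 := by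
  rw [content, ← Finsupp.sum_finsetSum_index]
  · simp
  · simp
  · intros; ring

/-- Entries are at least their row index, while the content fixes their sum as the sum of row
indices of θ. The hypothesis forces equality everywhere, so the content of T is η itself. The sum of
row indices stands in for the dominance order. -/
theorem eq_of_content_eq_highestWeight {N : ℕ} {θ η : N.Partition}
    (T : SemistandardYoungTableau (diagram η))
    (hT : content T = content (SemistandardYoungTableau.highestWeight (diagram θ)))
    (h : ∑ c ∈ (diagram θ).cells, c.1 ≤ ∑ c ∈ (diagram η).cells, c.1) : η = θ := by
  have hw : ∀ μ : YoungDiagram, ∑ c ∈ μ.cells, SemistandardYoungTableau.highestWeight μ c.1 c.2 =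
      ∑ c ∈ μ.cells, c.1 := fun μ => Finset.sum_congr rfl fun c hc => by
    rw [SemistandardYoungTableau.highestWeight_apply, if_pos ((YoungDiagram.mem_cells _).mp hc)]
  have h1 := sum_content T
  rw [hT, sum_content, hw] at h1
  have hle : ∀ c ∈ (diagram η).cells, c.1 ≤ T c.1 c.2 := fun c hc =>
    le_tableau_entry T ((YoungDiagram.mem_cells _).mp hc)
  have h2 : ∑ c ∈ (diagram η).cells, c.1 = ∑ c ∈ (diagram η).cells, T c.1 c.2 :=
    le_antisymm (Finset.sum_le_sum hle) (h1 ▸ h)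
  have h3 := (Finset.sum_eq_sum_iff_of_le hle).mp h2
  have h4 : content T = content (SemistandardYoungTableau.highestWeight (diagram η)) := by
    refine Finset.sum_congr rfl fun c hc => ?_
    rw [SemistandardYoungTableau.highestWeight_apply, if_pos ((YoungDiagram.mem_cells _).mp hc),
      ← h3 c hc]
  refine rows_injective ?_
  funext v
  rw [← content_highestWeight_apply, ← content_highestWeight_apply, ← h4, hT]

/-- Take θ with nonzero coefficient and least sum of row indices. Among the shapes with nonzero
coefficient, only θ contributes to the monomial x^θ. -/
theorem schurSeries_linearIndependent {N : ℕ} {c : N.Partition → ℚ}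
    (h : ∑ θ, c θ • schurSeries θ = 0) : c = 0 := by
  by_contra hc
  obtain ⟨θ₀, h₀⟩ := Function.ne_iff.mp hc
  obtain ⟨θ, hθ, hmin⟩ := Finset.exists_min_image (Finset.univ.filter fun θ => c θ ≠ 0)
    (fun θ => ∑ x ∈ (diagram θ).cells, x.1) ⟨θ₀, by simpa using h₀⟩
  have h1 := congrArg
    (MvPowerSeries.coeff (content (SemistandardYoungTableau.highestWeight (diagram θ)))) h
  rw [map_sum, map_zero, Finset.sum_eq_single θ] at h1
  · rw [map_smul, smul_eq_mul, mul_eq_zero] at h1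
    rcases h1 with h1 | h1
    · simp [h1] at hθ
    · change ((Nat.card _ : ℕ) : ℚ) = 0 at h1
      rw [Nat.cast_eq_zero, Nat.card_eq_zero] at h1
      rcases h1 with h1 | h1
      · exact h1.elim ⟨_, rfl⟩
      · exact h1.not_finite (finite_tableaux _)
  · intro η _ hη
    rw [map_smul, smul_eq_mul, mul_eq_zero]
    by_cases hcη : c η = 0
    · exact Or.inl hcη
    · right
      change ((Nat.card _ : ℕ) : ℚ) = 0
      rw [Nat.cast_eq_zero, Nat.card_eq_zero]
      left
      exact ⟨fun T => hη (eq_of_content_eq_highestWeight T.1 T.2 (hmin η (by simpa using hcη)))⟩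
  · intro h; exact absurd (Finset.mem_univ _) h

/-! ### Algebraic independence of the power sums -/

theorem coeff_psumSeries (k : ℕ+) (a : ℕ →₀ ℕ) : MvPowerSeries.coeff a (psumSeries k) =
    open Classical in if ∃ j : ℕ, a = Finsupp.single j (k : ℕ) then 1 else 0 := rfl

theorem coeff_psumSeries_nonneg (k : ℕ+) (a : ℕ →₀ ℕ) :
    0 ≤ MvPowerSeries.coeff a (psumSeries k) := by
  rw [coeff_psumSeries]; split_ifs <;> norm_num

theorem coeff_prod_psumSeries_nonneg (s : Multiset ℕ+) (e : ℕ →₀ ℕ) :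
    0 ≤ MvPowerSeries.coeff e (s.map psumSeries).prod := by
  classical
  induction s using Multiset.induction_on generalizing e with
  | empty =>
    rw [Multiset.map_zero, Multiset.prod_zero, MvPowerSeries.coeff_one]
    split_ifs <;> norm_num
  | cons k s ih =>
    rw [Multiset.map_cons, Multiset.prod_cons, MvPowerSeries.coeff_mul]
    exact Finset.sum_nonneg fun x _ => mul_nonneg (coeff_psumSeries_nonneg _ _) (ih _)

theorem map_support_single_add {e : ℕ →₀ ℕ} {j k : ℕ} (hk : k ≠ 0) (hj : j ∉ e.support) :
    (Finsupp.single j k + e).support.val.map (Finsupp.single j k + e) =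
      k ::ₘ e.support.val.map e := by
  classical
  have h0 : e j = 0 := by simpa using hj
  have h1 : (Finsupp.single j k + e).support = insert j e.support := by
    ext i
    by_cases hi : i = j
    · subst hi; simp [hk]
    · simp [hi]
  rw [h1, Finset.insert_val_of_notMem hj, Multiset.map_cons]
  congr 1
  · simp [h0]
  · refine Multiset.map_congr rfl fun i hi => ?_
    have : i ≠ j := by rintro rfl; exact hj hi
    simp [this]

/-- Each factor contributes a power of one variable. If the number of variables reaches the number
of factors, no two choices coincide and the exponents are exactly the parts. -/
theorem support_of_coeff_prod_psumSeries_ne_zero (s : Multiset ℕ+) (e : ℕ →₀ ℕ)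
    (h : MvPowerSeries.coeff e (s.map psumSeries).prod ≠ 0) :
    e.support.card ≤ s.card ∧
      (e.support.card = s.card → e.support.val.map e = s.map (fun k : ℕ+ => (k : ℕ))) := by
  classical
  induction s using Multiset.induction_on generalizing e with
  | empty =>
    rw [Multiset.map_zero, Multiset.prod_zero, MvPowerSeries.coeff_one] at h
    have : e = 0 := by by_contra h'; exact h (if_neg h')
    subst this
    simp
  | cons k s ih =>
    rw [Multiset.map_cons, Multiset.prod_cons, MvPowerSeries.coeff_mul] at h
    obtain ⟨⟨a, b⟩, hab, hne⟩ := Finset.exists_ne_zero_of_sum_ne_zero h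
    rw [mem_antidiagonal] at hab
    obtain ⟨h1, h2⟩ := ne_zero_and_ne_zero_of_mul hne
    obtain ⟨h3, h4⟩ := ih b h2
    have h5 : ∃ j : ℕ, a = Finsupp.single j (k : ℕ) := by
      by_contra h'
      exact h1 (by rw [coeff_psumSeries, if_neg h'])
    obtain ⟨j, rfl⟩ := h5
    dsimp only at hab
    subst hab
    have h6 : (Finsupp.single j (k : ℕ) + b).support ⊆ insert j b.support := by
      refine Finsupp.support_add.trans ?_
      rw [Finset.insert_eq]
      exact Finset.union_subset_union Finsupp.support_single_subset le_rfl
    have h7 := Finset.card_le_card h6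
    have h8 := Finset.card_insert_le j b.support
    rw [Multiset.card_cons]
    refine ⟨by omega, fun h9 => ?_⟩
    have hj : j ∉ b.support := fun hj => by
      rw [Finset.insert_eq_of_mem hj] at h7
      omega
    rw [map_support_single_add k.ne_zero hj, Multiset.map_cons, h4 (by omega)]

theorem exists_coeff_prod_psumSeries_pos (s : Multiset ℕ+) :
    ∃ e : ℕ →₀ ℕ, e.support.card = s.card ∧
      e.support.val.map e = s.map (fun k : ℕ+ => (k : ℕ)) ∧
      0 < MvPowerSeries.coeff e (s.map psumSeries).prod := by
  classical
  induction s using Multiset.induction_on with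
  | empty => exact ⟨0, by simp⟩
  | cons k s ih =>
    obtain ⟨e, h0, h1, h2⟩ := ih
    obtain ⟨j, hj⟩ := Infinite.exists_notMem_finset e.support
    have h3 := map_support_single_add k.ne_zero hj
    refine ⟨Finsupp.single j (k : ℕ) + e, ?_, ?_, ?_⟩
    · have := congrArg Multiset.card h3
      simpa [h0] using this
    · rw [h3, Multiset.map_cons, h1]
    · rw [Multiset.map_cons, Multiset.prod_cons, MvPowerSeries.coeff_mul]
      refine Finset.sum_pos' (fun x _ => mul_nonneg (coeff_psumSeries_nonneg _ _)
        (coeff_prod_psumSeries_nonneg _ _)) ⟨(Finsupp.single j (k : ℕ), e), by simp, ?_⟩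
      refine mul_pos ?_ h2
      rw [coeff_psumSeries, if_pos ⟨j, rfl⟩]
      exact one_pos

theorem realize_monomial (d : ℕ+ →₀ ℕ) (c : ℚ) :
    realize (MvPolynomial.monomial d c) = c • ((Finsupp.toMultiset d).map psumSeries).prod := by
  rw [realize, MvPolynomial.aeval_monomial, Algebra.smul_def, Finsupp.toMultiset_map,
    Finsupp.prod_toMultiset, Finsupp.prod_mapDomain_index] <;> simp [pow_add]

/-- The power sums in countably many variables are algebraically independent. -/
theorem realize_injective : Function.Injective realize := by
  rw [injective_iff_map_eq_zero]
  intro F hF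
  by_contra hne
  -- With d having the most parts, a monomial with the parts of d as exponents of distinct variables
  -- can come from no other term of F.
  obtain ⟨d, hd, hmax⟩ := Finset.exists_max_image F.support
    (fun d => (Finsupp.toMultiset d).card) (MvPolynomial.support_nonempty.mpr hne)
  obtain ⟨e, he0, he1, he2⟩ := exists_coeff_prod_psumSeries_pos (Finsupp.toMultiset d)
  have h1 := congrArg (MvPowerSeries.coeff e) hF
  rw [F.as_sum, map_sum, map_sum, map_zero, Finset.sum_eq_single d] at h1
  · rw [realize_monomial, map_smul, smul_eq_mul, mul_eq_zero] at h1
    rcases h1 with h1 | h1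
    · exact MvPolynomial.mem_support_iff.mp hd h1
    · exact he2.ne' h1
  · intro d' hd' hdd
    rw [realize_monomial, map_smul, smul_eq_mul, mul_eq_zero]
    right
    by_contra h2
    obtain ⟨h3, h4⟩ := support_of_coeff_prod_psumSeries_ne_zero _ _ h2
    have h5 := h4 (le_antisymm h3 (he0 ▸ hmax d' hd'))
    rw [he1] at h5
    have h6 := Multiset.map_injective PNat.coe_injective h5
    exact hdd (by classical simpa using (congrArg Multiset.toFinsupp h6).symm)
  · intro h; exact absurd hd h

/-! ### Sorting signs and the sum of Schur functions with at most four rows -/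

/-- The sign of an integer. -/
def sgn (z : ℤ) : ℤ := if 0 < z then 1 else if z < 0 then -1 else 0

theorem sgn_neg (z : ℤ) : sgn (-z) = -sgn z := by
  unfold sgn; split_ifs <;> omega

theorem sgn_sub_comm (x y : ℤ) : sgn (y - x) = -sgn (x - y) := by
  rw [← sgn_neg, neg_sub]

/-- The Pfaffian of the matrix of signs of differences. -/
def signPfaffian (b : Fin 4 → ℤ) : ℤ :=
  sgn (b 0 - b 1) * sgn (b 2 - b 3) - sgn (b 0 - b 2) * sgn (b 1 - b 3) +
    sgn (b 0 - b 3) * sgn (b 1 - b 2)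

theorem signPfaffian_swap (b : Fin 4 → ℤ) {i j : Fin 4} (hij : i ≠ j) :
    signPfaffian (b ∘ Equiv.swap i j) = -signPfaffian b := by
  unfold signPfaffian
  have h10 := sgn_sub_comm (b 0) (b 1)
  have h20 := sgn_sub_comm (b 0) (b 2)
  have h30 := sgn_sub_comm (b 0) (b 3)
  have h21 := sgn_sub_comm (b 1) (b 2)
  have h31 := sgn_sub_comm (b 1) (b 3)
  have h32 := sgn_sub_comm (b 2) (b 3)
  fin_cases i <;> fin_cases j <;> first
    | exact absurd rfl hij
    | (simp [Equiv.swap_apply_def, h10, h20, h30, h21, h31, h32]; try ring)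

theorem signPfaffian_comp_perm (b : Fin 4 → ℤ) (σ : Equiv.Perm (Fin 4)) :
    signPfaffian (b ∘ σ) = (Equiv.Perm.sign σ : ℤ) * signPfaffian b := by
  induction σ using Equiv.Perm.swap_induction_on' with
  | one => simp
  | mul_swap f x y hxy ih =>
    rw [Equiv.Perm.coe_mul, ← Function.comp_assoc, signPfaffian_swap _ hxy, ih,
      Equiv.Perm.sign_mul, Equiv.Perm.sign_swap hxy]
    push_cast; ring

theorem signPfaffian_of_strictAnti {b : Fin 4 → ℤ} (hb : StrictAnti b) : signPfaffian b = 1 := by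
  have h : ∀ {i j : Fin 4}, i < j → sgn (b i - b j) = 1 := fun hij => by
    rw [sgn, if_pos (sub_pos.mpr (hb hij))]
  rw [signPfaffian, h (by decide), h (by decide), h (by decide), h (by decide), h (by decide),
    h (by decide)]
  norm_num

theorem exists_perm_strictAnti {r : ℕ} {b : Fin r → ℤ} (hb : Function.Injective b) :
    ∃ σ : Equiv.Perm (Fin r), StrictAnti (b ∘ σ) := by
  refine ⟨Tuple.sort (fun i => -b i), ?_⟩
  have h1 := Tuple.monotone_sort fun i => -b i
  have h2 : Antitone (b ∘ Tuple.sort fun i => -b i) := fun i j hij => by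
    have := h1 hij
    simp only [Function.comp_apply, neg_le_neg_iff] at this
    exact this
  exact h2.strictAnti_of_injective (hb.comp (Equiv.injective _))

/-- The Pfaffian is alternating and equals 1 on decreasing tuples, so for distinct entries it is the
sign of the unique sorting permutation. With a repeated entry nothing sorts b strictly, and swapping
the equal entries shows that the Pfaffian is 0. -/
theorem sum_sign_strictAnti (b : Fin 4 → ℤ) :
    ∑ σ : Equiv.Perm (Fin 4), (if StrictAnti (b ∘ σ) then (Equiv.Perm.sign σ : ℤ) else 0) =
      signPfaffian b := by
  by_cases hb : Function.Injective b
  · obtain ⟨τ, hτ⟩ := exists_perm_strictAnti hb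
    rw [Finset.sum_eq_single τ]
    · have h1 := signPfaffian_comp_perm b τ
      rw [signPfaffian_of_strictAnti hτ] at h1
      rw [if_pos hτ]
      rcases Int.units_eq_one_or (Equiv.Perm.sign τ) with h2 | h2 <;> rw [h2] at h1 ⊢ <;>
        push_cast at h1 ⊢ <;> omega
    · intro σ _ hσ
      rw [if_neg]
      intro h
      apply hσ
      have h1 := Tuple.unique_antitone h.antitone hτ.antitone
      ext i
      exact congrArg Fin.val (hb (congrFun h1 i))
    · intro h; exact absurd (Finset.mem_univ _) h
  · rw [Finset.sum_eq_zero]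
    · rw [Function.not_injective_iff] at hb
      obtain ⟨i, j, h1, h2⟩ := hb
      have h3 := signPfaffian_swap b h2
      have h4 : b ∘ Equiv.swap i j = b := by
        funext k
        simp only [Function.comp_apply, Equiv.swap_apply_def]
        split_ifs with h5 h6
        · rw [h5, h1]
        · rw [h6, h1]
        · rfl
      rw [h4] at h3
      omega
    · intro σ _
      rw [if_neg]
      intro h
      exact hb ((Equiv.injective_comp σ b).mp h.injective)

/-- Partitions of `N` with at most `r` parts, as weakly decreasing `r`-tuples. -/
def antitoneTuples (r N : ℕ) : Finset (Fin r → ℕ) :=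
  open Classical in (Finset.Nat.antidiagonalTuple r N).filter Antitone

theorem mem_antitoneTuples {r N : ℕ} {a : Fin r → ℕ} :
    a ∈ antitoneTuples r N ↔ ∑ i, a i = N ∧ Antitone a := by
  classical
  rw [antitoneTuples, Finset.mem_filter, Finset.Nat.mem_antidiagonalTuple]

theorem antitone_of_strictAnti_sub {r : ℕ} {c : Fin r → ℤ}
    (h : StrictAnti fun k => c k - (k : ℕ)) : Antitone c := by
  have key : ∀ m : ℕ, ∀ i j : Fin r, (j : ℕ) = i + m → c j ≤ c i := by
    intro m
    induction m with
    | zero =>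
      intro i j hij
      rw [Fin.ext (a := j) (b := i) (by omega)]
    | succ m ih =>
      intro i j hij
      have h1 := ih i ⟨i + m, by omega⟩ rfl
      have h2 := h (show (⟨i + m, by omega⟩ : Fin r) < j from Fin.lt_def.mpr (by simp; omega))
      simp only [hij] at h2
      push_cast at h2
      omega
  intro i j hij
  exact key (j - i) i j (by have := Fin.le_def.mp hij; omega)

/-- Substitute β_i = a_σ(i) - σ(i) + i. Then a being weakly decreasing means that the numbers β_i -
i, reordered by σ⁻¹, are strictly decreasing. -/
theorem sum_antitoneTuples_prod {r : ℕ} (N : ℕ) (σ : Equiv.Perm (Fin r)) :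
    ∑ a ∈ antitoneTuples r N, ∏ i, hZ (a (σ i) - (σ i : ℕ) + (i : ℕ)) =
      ∑ β ∈ Finset.Nat.antidiagonalTuple r N,
        if StrictAnti ((fun i => (β i : ℤ) - (i : ℕ)) ∘ σ.symm) then ∏ i, hsym (β i) else 0 := by
  classical
  have hsum : ∀ f : Fin r → ℤ, ∑ i, (f (σ i) - (σ i : ℕ) + (i : ℕ)) = ∑ i, f i := by
    intro f
    rw [Finset.sum_add_distrib, Finset.sum_sub_distrib, Equiv.sum_comp σ f,
      Equiv.sum_comp σ fun i : Fin r => ((i : ℕ) : ℤ)]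
    ring
  have hsum' : ∀ f : Fin r → ℤ, ∑ i, (f (σ.symm i) - (σ.symm i : ℕ) + (i : ℕ)) = ∑ i, f i := by
    intro f
    rw [Finset.sum_add_distrib, Finset.sum_sub_distrib, Equiv.sum_comp σ.symm f,
      Equiv.sum_comp σ.symm fun i : Fin r => ((i : ℕ) : ℤ)]
    ring
  -- Terms with a negative index vanish, so β may be taken in the natural numbers.
  rw [← Finset.sum_filter, ← Finset.sum_filter_of_ne
    (p := fun a : Fin r → ℕ => ∀ i, 0 ≤ (a (σ i) : ℤ) - (σ i : ℕ) + (i : ℕ))]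
  · refine Finset.sum_bij' (fun a _ i => ((a (σ i) : ℤ) - (σ i : ℕ) + (i : ℕ)).toNat)
      (fun β _ i => ((β (σ.symm i) : ℤ) - (σ.symm i : ℕ) + (i : ℕ)).toNat) ?_ ?_ ?_ ?_ ?_
    · intro a ha
      obtain ⟨h1, h2⟩ := Finset.mem_filter.mp ha
      obtain ⟨h3, h4⟩ := mem_antitoneTuples.mp h1
      refine Finset.mem_filter.mpr ⟨?_, ?_⟩
      · rw [Finset.Nat.mem_antidiagonalTuple]
        zify
        rw [← h3, Finset.sum_congr rfl fun i _ => Int.toNat_of_nonneg (h2 i),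
          hsum fun i => (a i : ℤ)]
        push_cast; rfl
      · intro i j hij
        simp only [Function.comp_apply]
        rw [Int.toNat_of_nonneg (h2 _), Int.toNat_of_nonneg (h2 _), Equiv.apply_symm_apply,
          Equiv.apply_symm_apply]
        have := h4 hij.le
        have := Fin.lt_def.mp hij
        omega
    · intro β hβ
      obtain ⟨h1, h2⟩ := Finset.mem_filter.mp hβ
      rw [Finset.Nat.mem_antidiagonalTuple] at h1
      have h3 : Antitone fun i => (β (σ.symm i) : ℤ) - (σ.symm i : ℕ) + (i : ℕ) := by
        refine antitone_of_strictAnti_sub ?_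
        simpa [Function.comp_def] using h2
      -- By monotonicity the last entry suffices, and there the added r - 1 outweighs the subtracted
      -- index.
      have h4 : ∀ i, 0 ≤ (β (σ.symm i) : ℤ) - (σ.symm i : ℕ) + (i : ℕ) := by
        intro i
        have hr : r - 1 < r := by have := i.2; omega
        have h5 := h3 (show i ≤ ⟨r - 1, hr⟩ from Fin.le_def.mpr (by have := i.2; simp; omega))
        have h6 := (σ.symm ⟨r - 1, hr⟩).2
        simp only at h5
        omega
      refine Finset.mem_filter.mpr ⟨mem_antitoneTuples.mpr ⟨?_, ?_⟩, ?_⟩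
      · zify
        rw [← h1, Finset.sum_congr rfl fun i _ => Int.toNat_of_nonneg (h4 i),
          hsum' fun i => (β i : ℤ)]
        push_cast; rfl
      · intro i j hij
        have := h3 hij
        simp only at this ⊢
        omega
      · intro i
        rw [Int.toNat_of_nonneg (h4 _), Equiv.symm_apply_apply]
        omega
    · intro a ha
      have h2 := (Finset.mem_filter.mp ha).2
      funext i
      have := h2 (σ.symm i)
      rw [Equiv.apply_symm_apply] at this
      simp only [Equiv.apply_symm_apply]
      omega
    · intro β hβ
      obtain ⟨h1, h2⟩ := Finset.mem_filter.mp hβ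
      have h3 : Antitone fun i => (β (σ.symm i) : ℤ) - (σ.symm i : ℕ) + (i : ℕ) := by
        refine antitone_of_strictAnti_sub ?_
        simpa [Function.comp_def] using h2
      funext i
      have hr : r - 1 < r := by have := i.2; omega
      have h5 := h3 (show σ i ≤ ⟨r - 1, hr⟩ from Fin.le_def.mpr (by have := (σ i).2; simp; omega))
      have h6 := (σ.symm ⟨r - 1, hr⟩).2
      simp only [Equiv.symm_apply_apply] at h5 ⊢
      omega
    · intro a ha
      have h2 := (Finset.mem_filter.mp ha).2
      refine Finset.prod_congr rfl fun i _ => ?_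
      rw [← hZ_natCast, Int.toNat_of_nonneg (h2 i)]
  · intro a _ h i
    by_contra hi
    exact h (Finset.prod_eq_zero (Finset.mem_univ i) (hZ_of_neg (not_le.mp hi)))

/-- The sum of all Schur functions `s_λ` with `λ ⊢ N` and at most four parts. -/
theorem sum_jacobiTrudi_antitoneTuples (N : ℕ) :
    ∑ a ∈ antitoneTuples 4 N, jacobiTrudi hZ (fun i => (a i : ℤ)) =
      ∑ β ∈ Finset.Nat.antidiagonalTuple 4 N,
        signPfaffian (fun i => (β i : ℤ) - (i : ℕ)) • ∏ i, hsym (β i) := by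
  simp only [jacobiTrudi, Matrix.det_apply, Matrix.of_apply, Units.smul_def]
  rw [Finset.sum_comm]
  simp only [← Finset.smul_sum, sum_antitoneTuples_prod]
  simp only [Finset.smul_sum]
  rw [Finset.sum_comm]
  refine Finset.sum_congr rfl fun β _ => ?_
  rw [← sum_sign_strictAnti, Finset.sum_smul]
  -- The sorting condition involves σ⁻¹, which has the same sign as σ.
  refine Finset.sum_equiv (Equiv.inv _) (by simp) fun σ _ => ?_
  rw [Equiv.inv_apply, Equiv.Perm.sign_inv, ite_smul, zero_smul, smul_ite, smul_zero]
  rfl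

theorem sum_antidiagonalTuple_four {M : Type*} [AddCommMonoid M] (N : ℕ)
    (f : ℕ → ℕ → ℕ → ℕ → M) :
    ∑ β ∈ Finset.Nat.antidiagonalTuple 4 N, f (β 0) (β 1) (β 2) (β 3) =
      ∑ m ∈ antidiagonal N, ∑ x ∈ antidiagonal m.1, ∑ y ∈ antidiagonal m.2,
        f x.1 x.2 y.1 y.2 := by
  have h1 : ∀ m : ℕ × ℕ, ∑ x ∈ antidiagonal m.1, ∑ y ∈ antidiagonal m.2, f x.1 x.2 y.1 y.2 =
      ∑ z ∈ antidiagonal m.1 ×ˢ antidiagonal m.2, f z.1.1 z.1.2 z.2.1 z.2.2 := fun m => by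
    rw [Finset.sum_product]
  rw [Finset.sum_congr rfl fun m _ => h1 m, Finset.sum_sigma']
  refine Finset.sum_bij' (fun β _ => ⟨(β 0 + β 1, β 2 + β 3), ((β 0, β 1), (β 2, β 3))⟩)
    (fun z _ => ![z.2.1.1, z.2.1.2, z.2.2.1, z.2.2.2]) ?_ ?_ ?_ ?_ ?_
  · intro β hβ
    rw [Finset.Nat.mem_antidiagonalTuple, Fin.sum_univ_four] at hβ
    simp
    omega
  · rintro ⟨⟨m, m'⟩, ⟨⟨x, x'⟩, ⟨y, y'⟩⟩⟩ hz
    simp at hz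
    rw [Finset.Nat.mem_antidiagonalTuple, Fin.sum_univ_four]
    simp
    omega
  · intro β _
    ext i
    fin_cases i <;> rfl
  · rintro ⟨⟨m, m'⟩, ⟨⟨x, x'⟩, ⟨y, y'⟩⟩⟩ hz
    simp at hz
    obtain ⟨h1, h2, h3⟩ := hz
    subst h2 h3
    rfl
  · intro β _; rfl

theorem sum_antidiagonalTuple_comp_perm {M : Type*} [AddCommMonoid M] {r : ℕ} (N : ℕ)
    (e : Equiv.Perm (Fin r)) (f : (Fin r → ℕ) → M) :
    ∑ β ∈ Finset.Nat.antidiagonalTuple r N, f (β ∘ e) =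
      ∑ β ∈ Finset.Nat.antidiagonalTuple r N, f β := by
  refine Finset.sum_equiv (Equiv.arrowCongr e.symm (Equiv.refl ℕ)) (fun β => ?_) fun β _ => ?_
  · rw [Finset.Nat.mem_antidiagonalTuple, Finset.Nat.mem_antidiagonalTuple]
    simp only [Equiv.arrowCongr_apply, Equiv.symm_symm, Function.comp_apply, Equiv.refl_apply]
    rw [Equiv.sum_comp e β]
  · rfl

/-! ### Generating functions for products of two complete homogeneous functions -/

/-- The generating function of the `h_u h_v` with `u - v = s`. -/
def diffSeries (s : ℕ) : PowerSeries Sym :=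
  PowerSeries.mk fun m => ∑ x ∈ antidiagonal m, if x.1 = x.2 + s then hsym x.1 * hsym x.2 else 0

/-- The generating function of the `sgn (u - v + s) h_u h_v`. -/
def signSeries (s : ℕ) : PowerSeries Sym :=
  PowerSeries.mk fun m =>
    ∑ x ∈ antidiagonal m, sgn ((x.1 : ℤ) - x.2 + s) • (hsym x.1 * hsym x.2)

theorem two_mul_sum_antidiagonal_zsmul (m : ℕ) (c : ℕ → ℕ → ℤ) :
    2 * ∑ x ∈ antidiagonal m, c x.1 x.2 • (hsym x.1 * hsym x.2) =
      ∑ x ∈ antidiagonal m, (c x.1 x.2 + c x.2 x.1) • (hsym x.1 * hsym x.2) := by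
  have h : ∑ x ∈ antidiagonal m, c x.1 x.2 • (hsym x.1 * hsym x.2) =
      ∑ x ∈ antidiagonal m, c x.2 x.1 • (hsym x.1 * hsym x.2) := by
    rw [← Finset.Nat.sum_antidiagonal_swap]
    refine Finset.sum_congr rfl fun x _ => ?_
    simp only [Prod.fst_swap, Prod.snd_swap]
    rw [mul_comm]
  simp only [add_smul, Finset.sum_add_distrib]
  rw [two_mul, ← h]

/-- As h_u h_v is symmetric in u and v, only the symmetrized coefficients matter; the factor 2
cancels in the domain `Sym`. -/
theorem sum_antidiagonal_zsmul_eq {m : ℕ} {c c' : ℕ → ℕ → ℤ}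
    (h : ∀ u v, c u v + c v u = c' u v + c' v u) :
    ∑ x ∈ antidiagonal m, c x.1 x.2 • (hsym x.1 * hsym x.2) =
      ∑ x ∈ antidiagonal m, c' x.1 x.2 • (hsym x.1 * hsym x.2) := by
  have h2 : (2 : Sym) ≠ 0 := two_ne_zero
  refine mul_left_cancel₀ h2 ?_
  rw [two_mul_sum_antidiagonal_zsmul, two_mul_sum_antidiagonal_zsmul]
  exact Finset.sum_congr rfl fun x _ => by rw [h]

theorem coeff_diffSeries (s m : ℕ) : PowerSeries.coeff m (diffSeries s) =
    ∑ x ∈ antidiagonal m, (if x.1 = x.2 + s then 1 else 0 : ℤ) • (hsym x.1 * hsym x.2) := by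
  rw [diffSeries, PowerSeries.coeff_mk]
  exact Finset.sum_congr rfl fun x _ => by split_ifs <;> simp

/-- For x = u - v, the symmetrized sign sgn(x+s) + sgn(-x+s) is 2 for |x| < s, 1 for |x| = s and 0
beyond. The next two lemmas are the cases s = 2, 3. -/
theorem signSeries_one : signSeries 1 = diffSeries 0 + diffSeries 1 := by
  ext1 m
  rw [map_add, coeff_diffSeries, coeff_diffSeries, signSeries, PowerSeries.coeff_mk,
    ← Finset.sum_add_distrib]
  simp only [← add_smul]
  refine sum_antidiagonal_zsmul_eq (c := fun u v => sgn ((u : ℤ) - v + (1 : ℕ)))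
    (c' := fun u v => (if u = v + 0 then 1 else 0) + (if u = v + 1 then 1 else 0)) fun u v => ?_
  unfold sgn
  grind

theorem signSeries_two : signSeries 2 = diffSeries 0 + 2 * diffSeries 1 + diffSeries 2 := by
  ext1 m
  rw [two_mul, map_add, map_add, map_add, coeff_diffSeries, coeff_diffSeries, coeff_diffSeries,
    signSeries, PowerSeries.coeff_mk]
  simp only [← Finset.sum_add_distrib, ← add_smul]
  refine sum_antidiagonal_zsmul_eq (c := fun u v => sgn ((u : ℤ) - v + (2 : ℕ)))
    (c' := fun u v => (if u = v + 0 then 1 else 0) +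
      ((if u = v + 1 then 1 else 0) + (if u = v + 1 then 1 else 0)) +
      (if u = v + 2 then 1 else 0)) fun u v => ?_
  unfold sgn
  grind

theorem signSeries_three :
    signSeries 3 = diffSeries 0 + 2 * diffSeries 1 + 2 * diffSeries 2 + diffSeries 3 := by
  ext1 m
  rw [two_mul, two_mul]
  simp only [map_add, coeff_diffSeries]
  rw [signSeries, PowerSeries.coeff_mk]
  simp only [← Finset.sum_add_distrib, ← add_smul]
  refine sum_antidiagonal_zsmul_eq (c := fun u v => sgn ((u : ℤ) - v + (3 : ℕ)))
    (c' := fun u v => (if u = v + 0 then 1 else 0) +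
      ((if u = v + 1 then 1 else 0) + (if u = v + 1 then 1 else 0)) +
      ((if u = v + 2 then 1 else 0) + (if u = v + 2 then 1 else 0)) +
      (if u = v + 3 then 1 else 0)) fun u v => ?_
  unfold sgn
  grind

/-- The product of the h_(β_i) ignores order, so e may select any of the three pairings of the four
indices that occur in the Pfaffian. -/
theorem coeff_signSeries_mul (N s t : ℕ) (e : Equiv.Perm (Fin 4)) :
    PowerSeries.coeff N (signSeries s * signSeries t) =
      ∑ β ∈ Finset.Nat.antidiagonalTuple 4 N,
        (sgn ((β (e 0) : ℤ) - β (e 1) + s) * sgn ((β (e 2) : ℤ) - β (e 3) + t)) •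
          ∏ i, hsym (β i) := by
  have h1 := sum_antidiagonalTuple_comp_perm N e fun β : Fin 4 → ℕ =>
    (sgn ((β 0 : ℤ) - β 1 + s) * sgn ((β 2 : ℤ) - β 3 + t)) • ∏ i, hsym (β i)
  simp only [Function.comp_apply] at h1
  have h2 : ∀ β : Fin 4 → ℕ, ∏ i, hsym (β (e i)) = ∏ i, hsym (β i) := fun β =>
    Equiv.prod_comp e fun i => hsym (β i)
  simp only [h2] at h1
  rw [h1]
  simp only [Fin.prod_univ_four]
  rw [sum_antidiagonalTuple_four N fun a b c d =>
    (sgn ((a : ℤ) - b + s) * sgn ((c : ℤ) - d + t)) • (hsym a * hsym b * hsym c * hsym d)]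
  rw [PowerSeries.coeff_mul]
  refine Finset.sum_congr rfl fun m _ => ?_
  rw [signSeries, signSeries, PowerSeries.coeff_mk, PowerSeries.coeff_mk, Finset.sum_mul_sum]
  refine Finset.sum_congr rfl fun x _ => Finset.sum_congr rfl fun y _ => ?_
  rw [smul_mul_smul_comm, mul_assoc (hsym x.1 * hsym x.2)]

/-- With S_s for `signSeries s`, the Pfaffian terms give S_1 S_1 - S_2 S_2 + S_3 S_1. The shifts are
the distances between paired positions, because the Pfaffian is taken at β_i - i. -/
theorem sum_jacobiTrudi_eq_coeff (N : ℕ) :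
    ∑ a ∈ antitoneTuples 4 N, jacobiTrudi hZ (fun i => (a i : ℤ)) =
      PowerSeries.coeff N (diffSeries 0 * diffSeries 0 + diffSeries 0 * diffSeries 1 -
        diffSeries 1 * diffSeries 1 - diffSeries 2 * diffSeries 2 -
        2 * (diffSeries 1 * diffSeries 2) + diffSeries 0 * diffSeries 3 +
        diffSeries 1 * diffSeries 3) := by
  have h : diffSeries 0 * diffSeries 0 + diffSeries 0 * diffSeries 1 -
        diffSeries 1 * diffSeries 1 - diffSeries 2 * diffSeries 2 -
        2 * (diffSeries 1 * diffSeries 2) + diffSeries 0 * diffSeries 3 +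
        diffSeries 1 * diffSeries 3 = signSeries 1 * signSeries 1 - signSeries 2 * signSeries 2 +
          signSeries 3 * signSeries 1 := by
    rw [signSeries_one, signSeries_two, signSeries_three]
    ring
  let e : Equiv.Perm (Fin 4) := Equiv.swap 1 2
  let e' : Equiv.Perm (Fin 4) := Equiv.swap 1 2 * Equiv.swap 1 3
  rw [h, map_add, map_sub, coeff_signSeries_mul N 1 1 1, coeff_signSeries_mul N 2 2 e,
    coeff_signSeries_mul N 3 1 e', sum_jacobiTrudi_antitoneTuples, ← Finset.sum_sub_distrib,
    ← Finset.sum_add_distrib]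
  refine Finset.sum_congr rfl fun β _ => ?_
  have e0 : e 0 = 0 := by decide
  have e1 : e 1 = 2 := by decide
  have e2 : e 2 = 1 := by decide
  have e3 : e 3 = 3 := by decide
  have e0' : e' 0 = 0 := by decide
  have e1' : e' 1 = 3 := by decide
  have e2' : e' 2 = 1 := by decide
  have e3' : e' 3 = 2 := by decide
  rw [e0, e1, e2, e3, e0', e1', e2', e3', ← sub_smul, ← add_smul, signPfaffian]
  congr 1
  simp only [Equiv.Perm.one_apply]
  have v0 : ((0 : Fin 4) : ℕ) = 0 := rfl
  have v1 : ((1 : Fin 4) : ℕ) = 1 := rfl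
  have v2 : ((2 : Fin 4) : ℕ) = 2 := rfl
  have v3 : ((3 : Fin 4) : ℕ) = 3 := rfl
  rw [v0, v1, v2, v3]
  push_cast
  congr 1
  · congr 1
    · congr 2 <;> ring
    · congr 2 <;> ring
  · congr 2 <;> ring

/-- If u - v = s then u + v has the parity of s. -/
theorem coeff_diffSeries_mul_eq_zero {N s t : ℕ} (h : (N + s + t) % 2 = 1) :
    PowerSeries.coeff N (diffSeries s * diffSeries t) = 0 := by
  rw [PowerSeries.coeff_mul]
  refine Finset.sum_eq_zero fun m hm => ?_
  rw [mem_antidiagonal] at hm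
  have h0 : ∀ s m : ℕ, (m + s) % 2 = 1 → PowerSeries.coeff m (diffSeries s) = 0 := by
    intro s m hsm
    rw [diffSeries, PowerSeries.coeff_mk]
    refine Finset.sum_eq_zero fun x hx => ?_
    rw [mem_antidiagonal] at hx
    rw [if_neg (by omega)]
  by_cases h1 : (m.1 + s) % 2 = 1
  · rw [h0 _ _ h1, zero_mul]
  · rw [h0 t m.2 (by omega), mul_zero]

/-! ### Kronecker products of two-row shapes -/

theorem kron_comm (f g : Sym) : kron f g = kron g f := by
  ext d; simp only [coeff_kron]; ring

/-- In a matrix with rows (i, j), (k, l) the margins force i - l = a - d = s and j - k = c - a = t.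
Conversely, these two differences and the total determine the margins, so the matrices are counted
along their two diagonals. -/
theorem kron_hsym_eq_coeff {a b c d s t : ℕ} (h1 : a = d + s) (h2 : c = a + t)
    (h3 : a + b = c + d) :
    kron (hsym c * hsym d) (hsym a * hsym b) =
      PowerSeries.coeff (c + d) (diffSeries s * diffSeries t) := by
  have hL : kron (hsym c * hsym d) (hsym a * hsym b) =
      ∑ β ∈ Finset.Nat.antidiagonalTuple 4 (c + d),
        if β 0 + β 1 = c ∧ β 0 + β 2 = a ∧ β 1 + β 3 = b then
          hsym (β 0) * hsym (β 1) * (hsym (β 2) * hsym (β 3)) else 0 := by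
    rw [kron_hsym_mul_hsym, sum_antidiagonalTuple_four (c + d) fun i j k l =>
      if i + j = c ∧ i + k = a ∧ j + l = b then hsym i * hsym j * (hsym k * hsym l) else 0]
    symm
    rw [Finset.sum_eq_single (c, d)]
    · refine Finset.sum_congr rfl fun x hx => Finset.sum_congr rfl fun y _ => ?_
      rw [mem_antidiagonal] at hx
      refine if_congr ?_ rfl rfl
      simp only [hx, true_and]
    · intro m hm hne
      rw [mem_antidiagonal] at hm
      refine Finset.sum_eq_zero fun x hx => Finset.sum_eq_zero fun y _ => ?_
      rw [mem_antidiagonal] at hx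
      rw [if_neg]
      rintro ⟨h4, -⟩
      exact hne (Prod.ext (by simp only; omega) (by simp only; omega))
    · intro h; exact absurd (by simp) h
  let e : Equiv.Perm (Fin 4) := Equiv.swap 1 3 * Equiv.swap 2 3
  have hR := sum_antidiagonalTuple_comp_perm (c + d) e fun β : Fin 4 → ℕ =>
    if β 0 = β 1 + s ∧ β 2 = β 3 + t then
      hsym (β 0) * hsym (β 1) * (hsym (β 2) * hsym (β 3)) else 0
  rw [sum_antidiagonalTuple_four (c + d) fun i j k l => if i = j + s ∧ k = l + t then
    hsym i * hsym j * (hsym k * hsym l) else 0] at hR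
  have e0 : e 0 = 0 := by decide
  have e1 : e 1 = 3 := by decide
  have e2 : e 2 = 1 := by decide
  have e3 : e 3 = 2 := by decide
  simp only [Function.comp_apply, e0, e1, e2, e3] at hR
  rw [hL, PowerSeries.coeff_mul]
  refine Eq.trans (Finset.sum_congr rfl fun β hβ => ?_) (hR.trans ?_)
  · rw [Finset.Nat.mem_antidiagonalTuple, Fin.sum_univ_four] at hβ
    refine ite_congr (propext ?_) (fun _ => by ring) fun _ => rfl
    omega
  · refine Finset.sum_congr rfl fun m _ => ?_
    rw [diffSeries, diffSeries, PowerSeries.coeff_mk, PowerSeries.coeff_mk, Finset.sum_mul_sum]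
    refine Finset.sum_congr rfl fun x _ => Finset.sum_congr rfl fun y _ => ?_
    rw [ite_and]
    split_ifs <;> simp

/-- `s_{(m+2,m+1)} * s_{(m+2,m+1)}` is the sum of all `s_θ` with at most four parts. -/
theorem kron_odd (m : ℕ) :
    kron (hsym (m + 2) * hsym (m + 1) - hsym (m + 3) * hsym m)
        (hsym (m + 2) * hsym (m + 1) - hsym (m + 3) * hsym m) =
      ∑ a ∈ antitoneTuples 4 (2 * m + 3), jacobiTrudi hZ (fun i => (a i : ℤ)) := by
  rw [sum_jacobiTrudi_eq_coeff]
  simp only [map_add, map_sub, two_mul (diffSeries 1 * diffSeries 2)]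
  -- In odd degree, parity leaves D_0 D_1 - 2 D_1 D_2 + D_0 D_3 (D_s being `diffSeries s`), and the
  -- expanded Kronecker product supplies exactly these terms.
  rw [coeff_diffSeries_mul_eq_zero (s := 0) (t := 0) (by omega),
    coeff_diffSeries_mul_eq_zero (s := 1) (t := 1) (by omega),
    coeff_diffSeries_mul_eq_zero (s := 2) (t := 2) (by omega),
    coeff_diffSeries_mul_eq_zero (s := 1) (t := 3) (by omega)]
  simp only [kron_sub_left, kron_sub_right]
  rw [kron_comm (hsym (m + 2) * hsym (m + 1)) (hsym (m + 3) * hsym m),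
    kron_hsym_eq_coeff (s := 1) (t := 0) (by omega) (by omega) (by omega),
    kron_hsym_eq_coeff (s := 2) (t := 1) (by omega) (by omega) (by omega),
    kron_hsym_eq_coeff (s := 3) (t := 0) (by omega) (by omega) (by omega)]
  have h1 : m + 2 + (m + 1) = 2 * m + 3 := by ring
  have h2 : m + 3 + m = 2 * m + 3 := by ring
  rw [h1, h2, mul_comm (diffSeries 1) (diffSeries 0), mul_comm (diffSeries 2) (diffSeries 1),
    mul_comm (diffSeries 3) (diffSeries 0)]
  ring

/-- `(s_{(m+2,m+2)} + s_{(m+3,m+1)}) * s_{(m+2,m+2)}` is the sum of all `s_θ` with at most four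
parts. -/
theorem kron_even (m : ℕ) :
    kron (hsym (m + 2) * hsym (m + 2) - hsym (m + 4) * hsym m)
        (hsym (m + 2) * hsym (m + 2) - hsym (m + 3) * hsym (m + 1)) =
      ∑ a ∈ antitoneTuples 4 (2 * m + 4), jacobiTrudi hZ (fun i => (a i : ℤ)) := by
  rw [sum_jacobiTrudi_eq_coeff]
  simp only [map_add, map_sub, two_mul (diffSeries 1 * diffSeries 2)]
  -- In even degree, parity leaves D_0 D_0 - D_1 D_1 - D_2 D_2 + D_1 D_3, one term for each of the
  -- four products on the left.
  rw [coeff_diffSeries_mul_eq_zero (s := 0) (t := 1) (by omega),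
    coeff_diffSeries_mul_eq_zero (s := 1) (t := 2) (by omega),
    coeff_diffSeries_mul_eq_zero (s := 0) (t := 3) (by omega)]
  simp only [kron_sub_left, kron_sub_right]
  rw [kron_comm (hsym (m + 2) * hsym (m + 2)) (hsym (m + 3) * hsym (m + 1)),
    kron_hsym_eq_coeff (a := m + 2) (b := m + 2) (c := m + 2) (d := m + 2) (s := 0) (t := 0)
      (by omega) (by omega) (by omega),
    kron_hsym_eq_coeff (a := m + 2) (b := m + 2) (c := m + 3) (d := m + 1) (s := 1) (t := 1)
      (by omega) (by omega) (by omega),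
    kron_hsym_eq_coeff (a := m + 2) (b := m + 2) (c := m + 4) (d := m) (s := 2) (t := 2)
      (by omega) (by omega) (by omega),
    kron_hsym_eq_coeff (a := m + 3) (s := 3) (t := 1) (by omega) (by omega) (by omega)]
  have h1 : m + 2 + (m + 2) = 2 * m + 4 := by ring
  have h2 : m + 3 + (m + 1) = 2 * m + 4 := by ring
  have h3 : m + 4 + m = 2 * m + 4 := by ring
  rw [h1, h2, h3, mul_comm (diffSeries 3) (diffSeries 1)]
  ring

/-! ### Partitions as weakly decreasing tuples -/

theorem partsList_eq_of_pairwise {N : ℕ} {θ : N.Partition} {l : List ℕ}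
    (h1 : (l : Multiset ℕ) = θ.parts) (h2 : l.Pairwise (· ≥ ·)) : partsList θ = l := by
  refine List.Perm.eq_of_pairwise (fun a b _ _ hab hba => le_antisymm hba hab)
    (Multiset.pairwise_sort θ.parts (· ≥ ·)) h2 ?_
  rw [← Multiset.coe_eq_coe, h1]
  exact coe_partsList θ

theorem getD_filter_ne_zero {l : List ℕ} (h : l.Pairwise (· ≥ ·)) (i : ℕ) :
    (l.filter (· ≠ 0)).getD i 0 = l.getD i 0 := by
  induction l generalizing i with
  | nil => rfl
  | cons a l ih =>
    rw [List.pairwise_cons] at h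
    by_cases ha : a = 0
    · have h0 : ∀ b ∈ l, b = 0 := fun b hb => by have := h.1 b hb; omega
      have h1 : (a :: l).filter (· ≠ 0) = [] := by
        rw [List.filter_eq_nil_iff]
        intro b hb
        rcases List.mem_cons.mp hb with rfl | hb
        · simp [ha]
        · simp [h0 b hb]
      rw [h1, List.getD_nil]
      symm
      rcases lt_or_ge i (a :: l).length with hi | hi
      · rw [List.getD_eq_getElem _ _ hi]
        rcases List.mem_cons.mp (List.getElem_mem hi) with h2 | h2
        · rw [h2, ha]
        · exact h0 _ h2
      · rw [List.getD_eq_default _ _ hi]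
    · rw [List.filter_cons_of_pos (by simpa using ha)]
      cases i with
      | zero => rfl
      | succ i =>
        rw [List.getD_cons_succ, List.getD_cons_succ]
        exact ih h.2 i

/-- The partition with the nonzero entries of a tuple as its parts. -/
def ofTuple {r N : ℕ} (a : Fin r → ℕ) (ha : ∑ i, a i = N) : N.Partition :=
  Nat.Partition.ofSums N (Finset.univ.val.map a) ha

theorem rows_ofTuple {r N : ℕ} {a : Fin r → ℕ} (ha : ∑ i, a i = N) (h : Antitone a) (i : Fin r) :
    rows (ofTuple a ha) i = a i := by
  have h1 : (List.ofFn a).Pairwise (· ≥ ·) := List.pairwise_ofFn.mpr fun i j hij => h hij.le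
  have h2 : partsList (ofTuple a ha) = (List.ofFn a).filter (· ≠ 0) := by
    refine partsList_eq_of_pairwise ?_ (h1.filter _)
    rw [← Multiset.filter_coe]
    change _ = Multiset.filter (· ≠ 0) (Finset.univ.val.map a)
    congr 1
    · rw [Fin.univ_val_map]
  rw [rows, h2, getD_filter_ne_zero h1, List.getD_eq_getElem _ _ (by simp)]
  simp

theorem length_ofTuple_le {r N : ℕ} {a : Fin r → ℕ} (ha : ∑ i, a i = N) :
    length (ofTuple a ha) ≤ r := by
  refine (Multiset.card_le_card (Multiset.filter_le (· ≠ 0) (Finset.univ.val.map a))).trans ?_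
  simp

theorem list_sum_eq_sum_range_getD {l : List ℕ} {r : ℕ} (h : l.length ≤ r) :
    l.sum = ∑ i ∈ Finset.range r, l.getD i 0 := by
  induction l generalizing r with
  | nil => simp
  | cons a l ih =>
    cases r with
    | zero => simp at h
    | succ r =>
      rw [Finset.sum_range_succ', List.sum_cons, ih (r := r) (by simpa using h), add_comm]
      simp

theorem rows_mem_antitoneTuples {r N : ℕ} {θ : N.Partition} (h : length θ ≤ r) :
    (fun i : Fin r => rows θ i) ∈ antitoneTuples r N := by
  refine mem_antitoneTuples.mpr ⟨?_, fun i j hij => rows_antitone θ hij⟩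
  have h1 := θ.parts_sum
  rw [← coe_partsList, Multiset.sum_coe,
    list_sum_eq_sum_range_getD (r := r) (by rwa [length_partsList]), Finset.sum_range] at h1
  exact h1

theorem rows_ext {r N : ℕ} {θ η : N.Partition} (hθ : length θ ≤ r) (hη : length η ≤ r)
    (h : ∀ i : Fin r, rows θ i = rows η i) : θ = η := by
  refine rows_injective (funext fun i => ?_)
  rcases lt_or_ge i r with hi | hi
  · exact h ⟨i, hi⟩
  · rw [rows_eq_zero θ (hθ.trans hi), rows_eq_zero η (hη.trans hi)]

theorem sum_partition_eq_sum_antitoneTuples {M : Type*} [AddCommMonoid M] (r N : ℕ)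
    (f : (Fin r → ℕ) → M) :
    ∑ θ : N.Partition, (if length θ ≤ r then f (fun i => rows θ i) else 0) =
      ∑ a ∈ antitoneTuples r N, f a := by
  rw [← Finset.sum_filter]
  refine Finset.sum_bij' (fun θ _ i => rows θ i)
    (fun a ha => ofTuple a (mem_antitoneTuples.mp ha).1) ?_ ?_ ?_ ?_ ?_
  · intro θ hθ
    exact rows_mem_antitoneTuples (Finset.mem_filter.mp hθ).2
  · intro a ha
    exact Finset.mem_filter.mpr ⟨Finset.mem_univ _, length_ofTuple_le _⟩
  · intro θ hθ
    have h := (Finset.mem_filter.mp hθ).2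
    exact rows_ext (length_ofTuple_le _) h fun i =>
      rows_ofTuple _ (mem_antitoneTuples.mp (rows_mem_antitoneTuples h)).2 i
  · intro a ha
    funext i
    exact rows_ofTuple _ (mem_antitoneTuples.mp ha).2 i
  · intros; rfl

/-- Each distinct part is counted at its last occurrence, that is, at the corner of the diagram
ending its block of equal rows. -/
theorem numDistinct_eq_card_descents {r N : ℕ} {θ : N.Partition} (h : length θ ≤ r) :
    numDistinct θ = ((Finset.range r).filter fun i => rows θ (i + 1) < rows θ i).card := by
  classical
  symm
  refine Finset.card_bij (fun i _ => rows θ i) ?_ ?_ ?_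
  · intro i hi
    have h1 := (Finset.mem_filter.mp hi).2
    have h2 : i < length θ := by
      by_contra hc
      rw [rows_eq_zero θ (not_lt.mp hc)] at h1
      omega
    rw [← length_partsList] at h2
    rw [Multiset.mem_toFinset, ← coe_partsList, Multiset.mem_coe, rows, List.getD_eq_getElem _ _ h2]
    exact List.getElem_mem h2
  · intro i hi j hj hij
    have h1 := (Finset.mem_filter.mp hi).2
    have h2 := (Finset.mem_filter.mp hj).2
    rcases lt_trichotomy i j with h3 | h3 | h3
    · have := rows_antitone θ (show i + 1 ≤ j from h3); omega
    · exact h3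
    · have := rows_antitone θ (show j + 1 ≤ i from h3); omega
  · intro v hv
    rw [Multiset.mem_toFinset, ← coe_partsList, Multiset.mem_coe] at hv
    obtain ⟨i, hi, hiv⟩ := List.getElem_of_mem hv
    have hv0 : 0 < v := θ.parts_pos (by rw [← coe_partsList]; exact hv)
    have hiv' : rows θ i = v := by rw [rows, List.getD_eq_getElem _ _ hi, hiv]
    rw [length_partsList] at hi
    let S := (Finset.range r).filter fun i => rows θ i = v
    have hS : S.Nonempty := ⟨i, Finset.mem_filter.mpr ⟨Finset.mem_range.mpr (by omega), hiv'⟩⟩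
    have hmax := S.max'_mem hS
    obtain ⟨h1, h2⟩ := Finset.mem_filter.mp hmax
    refine ⟨S.max' hS, Finset.mem_filter.mpr ⟨h1, ?_⟩, h2⟩
    refine lt_of_le_of_ne (rows_antitone θ (Nat.le_succ _)) fun h3 => ?_
    have h4 : S.max' hS + 1 ∈ S := by
      refine Finset.mem_filter.mpr ⟨?_, h3.trans h2⟩
      rw [Finset.mem_range]
      by_contra hc
      rw [rows_eq_zero θ (by omega)] at h3
      omega
    have h5 := S.le_max' _ h4
    omega

/-! ### Adding and removing cells -/

/-- Add a cell to row `i`. -/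
def addCell {r : ℕ} (i : Fin r) (c : Fin r → ℕ) : Fin r → ℕ := Function.update c i (c i + 1)

/-- Remove a cell from row `i`. -/
def removeCell {r : ℕ} (i : Fin r) (c : Fin r → ℕ) : Fin r → ℕ := Function.update c i (c i - 1)

theorem addCell_apply {r : ℕ} (i j : Fin r) (c : Fin r → ℕ) :
    addCell i c j = if j = i then c i + 1 else c j := by
  rw [addCell, Function.update_apply]

theorem removeCell_apply {r : ℕ} (i j : Fin r) (c : Fin r → ℕ) :
    removeCell i c j = if j = i then c i - 1 else c j := by
  rw [removeCell, Function.update_apply]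

theorem sum_addCell {r : ℕ} (i : Fin r) (c : Fin r → ℕ) :
    ∑ j, addCell i c j = ∑ j, c j + 1 := by
  rw [addCell, Finset.sum_update_of_mem (Finset.mem_univ i),
    ← Finset.add_sum_erase Finset.univ c (Finset.mem_univ i), Finset.sdiff_singleton_eq_erase]
  ring

theorem addCell_removeCell {r : ℕ} {i : Fin r} {c : Fin r → ℕ} (h : 0 < c i) :
    addCell i (removeCell i c) = c := by
  funext j
  rw [addCell_apply, removeCell_apply, removeCell_apply, if_pos rfl]
  split_ifs with hj
  · subst hj; omega
  · rfl

theorem removeCell_addCell {r : ℕ} (i : Fin r) (c : Fin r → ℕ) :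
    removeCell i (addCell i c) = c := by
  funext j
  rw [removeCell_apply, addCell_apply, addCell_apply, if_pos rfl]
  split_ifs with hj
  · subst hj; omega
  · rfl

/-- Monotonicity can fail only if rows i-1 and i had equal length; after the addition the
corresponding two rows of the determinant agree. -/
theorem jacobiTrudi_addCell_eq_zero {R : Type*} [CommRing R] (h : ℤ → R) {r : ℕ} {c : Fin r → ℕ}
    (hc : Antitone c) {i : Fin r} (hi : ¬ Antitone (addCell i c)) :
    jacobiTrudi h (fun j => (addCell i c j : ℤ)) = 0 := by
  by_cases h1 : ∃ j : Fin r, (j : ℕ) + 1 = i ∧ c j = c i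
  · obtain ⟨j, hj, hji⟩ := h1
    have hne : j ≠ i := by rintro rfl; omega
    refine jacobiTrudi_eq_zero h _ hne ?_
    rw [addCell_apply, addCell_apply, if_neg hne, if_pos rfl, ← hj, hji]
    push_cast; ring
  · refine absurd ?_ hi
    intro j k hjk
    rw [addCell_apply, addCell_apply]
    have h2 := hc hjk
    split_ifs with h3 h4 h4
    · exact le_rfl
    · subst h3
      have h5 := Fin.le_def.mp hjk
      have h6 : (j : ℕ) ≠ k := fun h => h4 (Fin.ext h)
      have h7 : (k : ℕ) - 1 < r := by omega
      have h8 := hc (show j ≤ ⟨k - 1, h7⟩ from Fin.le_def.mpr (by simp; omega))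
      have h9 := hc (show (⟨k - 1, h7⟩ : Fin r) ≤ k from Fin.le_def.mpr (by simp))
      have h10 : c ⟨k - 1, h7⟩ ≠ c k := fun h => h1 ⟨⟨k - 1, h7⟩, by simp; omega, h⟩
      omega
    · subst h4; omega
    · exact h2

theorem antitone_removeCell {r : ℕ} {b : Fin r → ℕ} (hb : Antitone b) {i : Fin r}
    (hi : nextEntry b i < b i) : Antitone (removeCell i b) := by
  intro j k hjk
  rw [removeCell_apply, removeCell_apply]
  have h2 := hb hjk
  split_ifs with h3 h4 h4
  · exact le_rfl
  · subst h3; omega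
  · subst h4
    have := nextEntry_of_lt hb (lt_of_le_of_ne hjk (Ne.symm h3))
    omega
  · exact h2

theorem nextEntry_addCell {r : ℕ} (i : Fin r) (c : Fin r → ℕ) :
    nextEntry (addCell i c) i = nextEntry c i := by
  unfold nextEntry
  split_ifs with h
  · rw [addCell_apply, if_neg]
    intro h'
    have := congrArg Fin.val h'
    simp at this
  · rfl

theorem sum_jacobiTrudi_addCell {R : Type*} [CommRing R] (h : ℤ → R) {r : ℕ} (M : ℕ)
    (P : (Fin r → ℕ) → Prop) [DecidablePred P] (i : Fin r) :
    ∑ c ∈ (antitoneTuples r M).filter P, jacobiTrudi h (fun j => (addCell i c j : ℤ)) =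
      ∑ b ∈ antitoneTuples r (M + 1), if nextEntry b i < b i ∧ P (removeCell i b) then
        jacobiTrudi h (fun j => (b j : ℤ)) else 0 := by
  classical
  rw [← Finset.sum_filter, ← Finset.sum_filter_of_ne (p := fun c => Antitone (addCell i c))]
  · refine Finset.sum_bij' (fun c _ => addCell i c) (fun b _ => removeCell i b) ?_ ?_ ?_ ?_ ?_
    · intro c hc
      rw [Finset.mem_filter, Finset.mem_filter, mem_antitoneTuples] at hc
      obtain ⟨⟨⟨h1, h2⟩, h3⟩, h4⟩ := hc
      rw [Finset.mem_filter, mem_antitoneTuples, sum_addCell, h1, removeCell_addCell,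
        nextEntry_addCell, addCell_apply, if_pos rfl]
      exact ⟨⟨rfl, h4⟩, Nat.lt_succ_of_le (nextEntry_le h2 i), h3⟩
    · intro b hb
      rw [Finset.mem_filter, mem_antitoneTuples] at hb
      obtain ⟨⟨h1, h2⟩, h3, h4⟩ := hb
      have h5 := addCell_removeCell (i := i) (c := b) (by omega)
      rw [Finset.mem_filter, Finset.mem_filter, mem_antitoneTuples, h5]
      refine ⟨⟨⟨?_, antitone_removeCell h2 h3⟩, h4⟩, h2⟩
      have h6 := sum_addCell i (removeCell i b)
      rw [h5] at h6
      omega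
    · intro c _; exact removeCell_addCell i c
    · intro b hb
      rw [Finset.mem_filter] at hb
      exact addCell_removeCell (by omega)
    · intros; rfl
  · intro c hc hne
    by_contra hcon
    rw [Finset.mem_filter, mem_antitoneTuples] at hc
    exact hne (jacobiTrudi_addCell_eq_zero h hc.1.2 hcon)

theorem sum_antitoneTuples_snoc {M : Type*} [AddCommMonoid M] (r N : ℕ)
    (f : (Fin (r + 1) → ℕ) → M) :
    ∑ a ∈ antitoneTuples r N, f (Fin.snoc a 0) =
      ∑ b ∈ (antitoneTuples (r + 1) N).filter (fun b => b (Fin.last r) = 0), f b := by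
  have h1 : ∀ b : Fin (r + 1) → ℕ, b (Fin.last r) = 0 →
      (Fin.snoc (fun i => b i.castSucc) 0 : Fin (r + 1) → ℕ) = b := by
    intro b hb
    funext i
    refine Fin.lastCases ?_ (fun i => ?_) i
    · rw [Fin.snoc_last, hb]
    · rw [Fin.snoc_castSucc]
  refine Finset.sum_bij' (fun a _ => (Fin.snoc a 0 : Fin (r + 1) → ℕ))
    (fun b _ i => b i.castSucc) ?_ ?_ ?_ ?_ ?_
  · intro a ha
    obtain ⟨h2, h3⟩ := mem_antitoneTuples.mp ha
    refine Finset.mem_filter.mpr ⟨mem_antitoneTuples.mpr ⟨?_, ?_⟩, Fin.snoc_last _ _⟩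
    · rw [Fin.sum_univ_castSucc]
      simpa using h2
    · intro i j hij
      induction j using Fin.lastCases with
      | last => rw [Fin.snoc_last]; exact Nat.zero_le _
      | cast j =>
        induction i using Fin.lastCases with
        | last => exact absurd (lt_of_le_of_lt hij j.castSucc_lt_last) (lt_irrefl _)
        | cast i =>
          rw [Fin.snoc_castSucc, Fin.snoc_castSucc]
          exact h3 (by simpa using hij)
  · intro b hb
    obtain ⟨h2, h3⟩ := Finset.mem_filter.mp hb
    obtain ⟨h4, h5⟩ := mem_antitoneTuples.mp h2
    rw [Fin.sum_univ_castSucc, h3, add_zero] at h4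
    exact mem_antitoneTuples.mpr ⟨h4, fun i j hij => h5 (by simpa using hij)⟩
  · intro a _; funext i; rw [Fin.snoc_castSucc]
  · intro b hb; exact h1 b (Finset.mem_filter.mp hb).2
  · intros; rfl

theorem cast_snoc_zero {r : ℕ} (a : Fin r → ℕ) :
    (fun i => (((Fin.snoc a 0 : Fin (r + 1) → ℕ) i : ℕ) : ℤ)) =
      (Fin.snoc (fun i => (a i : ℤ)) 0 : Fin (r + 1) → ℤ) := by
  funext i
  refine Fin.lastCases ?_ (fun i => ?_) i
  · simp
  · simp

theorem sum_jacobiTrudi_eq_filter (r N : ℕ) :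
    ∑ a ∈ antitoneTuples r N, jacobiTrudi hZ (fun i => (a i : ℤ)) =
      ∑ b ∈ antitoneTuples (r + 1) N,
        if b (Fin.last r) = 0 then jacobiTrudi hZ (fun i => (b i : ℤ)) else 0 := by
  rw [← Finset.sum_filter, ← sum_antitoneTuples_snoc]
  refine Finset.sum_congr rfl fun a _ => ?_
  rw [cast_snoc_zero, jacobiTrudi_snoc_zero hZ_zero fun m hm => hZ_of_neg hm]

/-- Pieri's rule read from the larger shape b: its multiplicity is the number of corners whose
removal leaves at most r rows, which is what the vanishing last entry records. -/
theorem hZ_one_mul_sum_jacobiTrudi (r M : ℕ) :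
    hZ 1 * ∑ a ∈ antitoneTuples r M, jacobiTrudi hZ (fun i => (a i : ℤ)) =
      ∑ b ∈ antitoneTuples (r + 1) (M + 1),
        (Finset.univ.filter fun i : Fin (r + 1) =>
          nextEntry b i < b i ∧ removeCell i b (Fin.last r) = 0).card •
            jacobiTrudi hZ (fun i => (b i : ℤ)) := by
  have h1 : ∀ a : Fin r → ℕ, hZ 1 * jacobiTrudi hZ (fun i => (a i : ℤ)) =
      ∑ i : Fin (r + 1), jacobiTrudi hZ
        (fun j => (addCell i (Fin.snoc a 0 : Fin (r + 1) → ℕ) j : ℤ)) := by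
    intro a
    rw [← sum_jacobiTrudi_update fun m hm => hZ_of_neg hm]
    refine Finset.sum_congr rfl fun i _ => ?_
    congr 1
    rw [← cast_snoc_zero]
    funext j
    rw [addCell_apply, Function.update_apply]
    split_ifs <;> push_cast <;> rfl
  rw [Finset.mul_sum, Finset.sum_congr rfl fun a _ => h1 a,
    sum_antitoneTuples_snoc r M fun c => ∑ i : Fin (r + 1), jacobiTrudi hZ
        (fun j => (addCell i c j : ℤ)), Finset.sum_comm,
    Finset.sum_congr rfl fun i _ =>
      sum_jacobiTrudi_addCell hZ M (fun b : Fin (r + 1) → ℕ => b (Fin.last r) = 0) i,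
    Finset.sum_comm]
  refine Finset.sum_congr rfl fun b _ => ?_
  rw [← Finset.sum_filter, Finset.sum_const]

/-! ### Reading off the coefficients -/

/-- The Kronecker coefficients of `s_{(n,n-1,1)} * s_{(n,n)}`. -/
def nearRectCoeff {N : ℕ} (θ : N.Partition) : ℚ :=
  if length θ = 5 ∧ part θ 5 = 1 then 1
  else if length θ ≤ 4 then (numDistinct θ : ℚ) - 1
  else 0

/-- With five rows, only a corner in a fifth row of length 1 can be removed to leave four rows, and
nothing is subtracted. With at most four rows every corner counts, giving the number of distinct
parts, and 1 is subtracted. -/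
theorem nearRectCoeff_of_length_le {N : ℕ} {θ : N.Partition} (h : length θ ≤ 5) :
    nearRectCoeff θ =
      ((Finset.univ.filter fun i : Fin 5 =>
        nextEntry (fun j : Fin 5 => rows θ j) i < rows θ i ∧
          removeCell i (fun j : Fin 5 => rows θ j) (Fin.last 4) = 0).card : ℚ) -
        if rows θ 4 = 0 then 1 else 0 := by
  have hnext : ∀ i : Fin 5, nextEntry (fun j : Fin 5 => rows θ j) i = rows θ (i + 1) := by
    intro i
    unfold nextEntry
    split_ifs with hi
    · rfl
    · rw [rows_eq_zero θ (by omega)]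
  have hpart : part θ 5 = rows θ 4 := rfl
  have hlast : ((Fin.last 4 : Fin 5) : ℕ) = 4 := rfl
  rcases Nat.lt_or_ge 4 (length θ) with h4 | h4
  · have h5 : length θ = 5 := by omega
    have hpos := rows_pos θ h4
    have h6 : rows θ 5 = 0 := rows_eq_zero θ h
    rw [nearRectCoeff, hpart, h5, if_neg (by norm_num : ¬ 5 ≤ 4), if_neg hpos.ne', sub_zero]
    have hset : (Finset.univ.filter fun i : Fin 5 =>
        nextEntry (fun j : Fin 5 => rows θ j) i < rows θ i ∧
          removeCell i (fun j : Fin 5 => rows θ j) (Fin.last 4) = 0) =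
        if rows θ 4 = 1 then {Fin.last 4} else ∅ := by
      ext i
      rw [Finset.mem_filter, hnext, removeCell_apply]
      by_cases hi : Fin.last 4 = i
      · subst hi
        rw [if_pos rfl]
        simp only [Finset.mem_univ, true_and, hlast, h6]
        split_ifs with h7
        · simp [h7]
        · simp only [Finset.notMem_empty, iff_false]
          omega
      · rw [if_neg hi, hlast]
        split_ifs with h7
        · simp [h7, Finset.mem_singleton.not.mpr (Ne.symm hi), -Fin.reduceLast]
        · simp [hpos.ne']
    rw [hset]
    by_cases h7 : rows θ 4 = 1 <;> simp [h7]
  · have h5 : rows θ 4 = 0 := rows_eq_zero θ h4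
    rw [nearRectCoeff, if_neg (by omega), if_pos h4, if_pos h5, numDistinct_eq_card_descents h]
    congr 2
    rw [Finset.card_filter, Finset.card_filter, Finset.sum_range]
    refine Finset.sum_congr rfl fun i _ => ?_
    refine if_congr ?_ rfl rfl
    rw [hnext, removeCell_apply]
    constructor
    · intro h7
      refine ⟨h7, ?_⟩
      rw [if_neg, hlast, h5]
      rintro rfl
      rw [hlast, h5] at h7
      omega
    · exact fun h7 => h7.1

theorem nearRectCoeff_of_lt_length {N : ℕ} {θ : N.Partition} (h : ¬ length θ ≤ 5) :
    nearRectCoeff θ = 0 := by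
  rw [nearRectCoeff, if_neg (by omega), if_neg (by omega)]

theorem sum_nearRectCoeff_smul_schurSeries (M : ℕ) :
    ∑ θ : (M + 1).Partition, nearRectCoeff θ • schurSeries θ =
      realize (hZ 1 * ∑ a ∈ antitoneTuples 4 M, jacobiTrudi hZ (fun i => (a i : ℤ)) -
        ∑ a ∈ antitoneTuples 4 (M + 1), jacobiTrudi hZ (fun i => (a i : ℤ))) := by
  rw [hZ_one_mul_sum_jacobiTrudi, sum_jacobiTrudi_eq_filter, ← Finset.sum_sub_distrib,
    ← sum_partition_eq_sum_antitoneTuples, map_sum]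
  refine Finset.sum_congr rfl fun θ _ => ?_
  by_cases h : length θ ≤ 5
  · rw [if_pos h, nearRectCoeff_of_length_le h, map_sub, map_nsmul, realize_jacobiTrudi θ h,
      sub_smul, Nat.cast_smul_eq_nsmul]
    congr 1
    by_cases h0 : rows θ 4 = 0
    · rw [if_pos h0, if_pos (c := (fun i : Fin 5 => rows θ i) (Fin.last 4) = 0) h0,
        realize_jacobiTrudi θ h, one_smul]
    · rw [if_neg h0, if_neg (c := (fun i : Fin 5 => rows θ i) (Fin.last 4) = 0) h0,
        map_zero, zero_smul]
  · rw [if_neg h, nearRectCoeff_of_lt_length h, zero_smul, map_zero]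

/-! ### The shapes (n,n) and (n,n-1,1) and their Kronecker product -/

theorem jacobiTrudi_pair (x y : ℤ) :
    jacobiTrudi hZ ![x, y] = hZ x * hZ y - hZ (x + 1) * hZ (y - 1) := by
  rw [jacobiTrudi, Matrix.det_fin_two]
  simp

/-- This is Pieri's rule for the two-row tuple (x, y), solved for the term with a new third row. -/
theorem jacobiTrudi_triple (x y : ℤ) :
    jacobiTrudi hZ ![x, y, 1] = hZ 1 * jacobiTrudi hZ ![x, y] -
      (jacobiTrudi hZ ![x + 1, y] + jacobiTrudi hZ ![x, y + 1]) := by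
  have h := sum_jacobiTrudi_update (fun m hm => hZ_of_neg hm) ![x, y]
  rw [Fin.sum_univ_three] at h
  have h0 : Function.update (Fin.snoc ![x, y] 0 : Fin 3 → ℤ) 0
      ((Fin.snoc ![x, y] 0 : Fin 3 → ℤ) 0 + 1) = Fin.snoc ![x + 1, y] 0 := by
    funext i; fin_cases i <;> rfl
  have h1 : Function.update (Fin.snoc ![x, y] 0 : Fin 3 → ℤ) 1
      ((Fin.snoc ![x, y] 0 : Fin 3 → ℤ) 1 + 1) = Fin.snoc ![x, y + 1] 0 := by
    funext i; fin_cases i <;> rfl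
  have h2 : Function.update (Fin.snoc ![x, y] 0 : Fin 3 → ℤ) 2
      ((Fin.snoc ![x, y] 0 : Fin 3 → ℤ) 2 + 1) = ![x, y, 1] := by
    funext i; fin_cases i <;> rfl
  rw [h0, h1, h2, jacobiTrudi_snoc_zero hZ_zero fun m hm => hZ_of_neg hm,
    jacobiTrudi_snoc_zero hZ_zero fun m hm => hZ_of_neg hm] at h
  rw [← h]
  ring

theorem realize_partNN (n : ℕ) (hn : 2 ≤ n) :
    realize (jacobiTrudi hZ ![(n : ℤ), (n : ℤ)]) = schurSeries (partNN n hn) := by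
  have hl : partsList (partNN n hn) = [n, n] :=
    partsList_eq_of_pairwise rfl (by simp)
  have h : ![(n : ℤ), (n : ℤ)] = fun i : Fin 2 => (rows (partNN n hn) i : ℤ) := by
    funext i
    rw [rows, hl]
    fin_cases i <;> rfl
  have hr : length (partNN n hn) ≤ 2 := by rw [← length_partsList, hl]; rfl
  rw [h, realize_jacobiTrudi _ hr]

theorem realize_partNearRect (n : ℕ) (hn : 2 ≤ n) :
    realize (jacobiTrudi hZ ![(n : ℤ), (n : ℤ) - 1, 1]) = schurSeries (partNearRect n hn) := by
  have hl : partsList (partNearRect n hn) = [n, n - 1, 1] :=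
    partsList_eq_of_pairwise rfl (by simp; omega)
  have h : ![(n : ℤ), (n : ℤ) - 1, 1] = fun i : Fin 3 => (rows (partNearRect n hn) i : ℤ) := by
    funext i
    rw [rows, hl]
    fin_cases i
    · rfl
    · change (n : ℤ) - 1 = ((n - 1 : ℕ) : ℤ)
      omega
    · rfl
  have hr : length (partNearRect n hn) ≤ 3 := by rw [← length_partsList, hl]; rfl
  rw [h, realize_jacobiTrudi _ hr]

/-- The Kronecker product `s_{(n,n-1,1)} * s_{(n,n)}` as a difference of multiplicity-free sums. -/
theorem kron_nearRect (m : ℕ) :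
    kron (jacobiTrudi hZ ![((m + 2 : ℕ) : ℤ), ((m + 2 : ℕ) : ℤ) - 1, 1])
        (jacobiTrudi hZ ![((m + 2 : ℕ) : ℤ), ((m + 2 : ℕ) : ℤ)]) =
      hZ 1 * ∑ a ∈ antitoneTuples 4 (2 * m + 3), jacobiTrudi hZ (fun i => (a i : ℤ)) -
        ∑ a ∈ antitoneTuples 4 (2 * m + 4), jacobiTrudi hZ (fun i => (a i : ℤ)) := by
  have hm : ∀ k : ℕ, hsym (m + k) = hZ (m + k) := fun k => by
    rw [← hZ_natCast]; push_cast; rfl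
  have hm0 : hsym m = hZ m := (hZ_natCast m).symm
  have hd : ∀ x : ℤ, MvPolynomial.pderiv 1 (hZ x) = hZ (x - 1) := fun x => by
    simpa using pderiv_hZ 1 x
  have i1 : (m : ℤ) + 2 + 1 = m + 3 := by ring
  have i2 : (m : ℤ) + 2 - 1 = m + 1 := by ring
  have i3 : (m : ℤ) + 1 - 1 = m := by ring
  have i4 : (m : ℤ) + 3 - 1 = m + 2 := by ring
  have i5 : (m : ℤ) + 3 + 1 = m + 4 := by ring
  have i6 : (m : ℤ) + 1 + 1 = m + 2 := by ring
  -- The factor h_1 = p_1 becomes a derivative of the second argument. It remains to see that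
  -- ∂s_(n,n)/∂p_1 = s_(n,n-1), and that s_(n+1,n-1) + s_(n,n) telescopes to h_n h_n - h_(n+2)
  -- h_(n-2).
  rw [jacobiTrudi_triple, kron_sub_left, hZ_one, kron_X_mul, ← kron_odd, ← kron_even]
  simp only [jacobiTrudi_pair, hm, hm0]
  push_cast
  simp only [i1, i2, i3, i4, i5, i6, Derivation.leibniz, map_sub, hd, smul_eq_mul]
  congr 1
  · congr 2
    ring
  · congr 1
    ring

theorem nearRect_expansion (n : ℕ) (hn : 2 ≤ n) :
    realize (kron (jacobiTrudi hZ ![(n : ℤ), (n : ℤ) - 1, 1])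
        (jacobiTrudi hZ ![(n : ℤ), (n : ℤ)])) =
      ∑ θ : (2 * n).Partition, nearRectCoeff θ • schurSeries θ := by
  obtain ⟨m, rfl⟩ : ∃ m, n = m + 2 := ⟨n - 2, by omega⟩
  rw [kron_nearRect]
  exact (sum_nearRectCoeff_smul_schurSeries (2 * m + 3)).symm

end SymFun

end

/-- The Schur expansion of `s_{(n,n-1,1)} * s_{(n,n)}` exists, is unique, and its coefficients
are given by the formula on the right. -/
theorem mainTheorem1 (n : ℕ) (hn : 2 ≤ n) (g : (2 * n).Partition → ℚ) :
    SymFun.IsKroneckerExpansion (SymFun.partNearRect n hn) (SymFun.partNN n hn) g ↔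
      ∀ θ : (2 * n).Partition, g θ =
        if SymFun.length θ = 5 ∧ SymFun.part θ 5 = 1 then 1
        else if SymFun.length θ ≤ 4 then (SymFun.numDistinct θ : ℚ) - 1
        else 0 := by
  have hF := SymFun.realize_partNearRect n hn
  have hG := SymFun.realize_partNN n hn
  have hFG := SymFun.nearRect_expansion n hn
  constructor
  · rintro ⟨F, G, h1, h2, h3⟩ θ
    -- The lifts of the two Schur series to Λ are unique, so any expansion concerns the same
    -- Kronecker product.
    obtain rfl := SymFun.realize_injective (h1.trans hF.symm)
    obtain rfl := SymFun.realize_injective (h2.trans hG.symm)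
    have h4 : ∑ θ, (g θ - SymFun.nearRectCoeff θ) • SymFun.schurSeries θ = 0 := by
      simp only [sub_smul, Finset.sum_sub_distrib]
      rw [← h3, hFG, sub_self]
    exact sub_eq_zero.mp (congrFun (SymFun.schurSeries_linearIndependent h4) θ)
  · intro h
    refine ⟨_, _, hF, hG, hFG.trans (Finset.sum_congr rfl fun θ _ => ?_)⟩
    rw [h θ]
    rfl
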